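/- Let $\beta\in\mathbb R$, and let $(Z_k)_{k\in\mathbb Z}$ be independent real random variables with $Z_k\sim N(0,|k|^{2\beta})$ for $k\ne 0$ and $Z_0\sim N(0,v_0)$, where $v_0\in[0,\infty)$ is arbitrary (for $v_0=0$, $Z_0=0$ almost surely). Let $\mathcal X=\sum_{k\in\mathbb Z}\delta_{k+Z_k}$ be the random counting measure on $\mathbb R$ of the points $k+Z_k$. (1) If $\beta>1/2$, then $\mathcal X$ is insertion tolerant: for every Borel set $A\subseteq\mathbb R$ with positive finite Lebesgue measure and $U$ uniform on $A$ and independent of $\mathcal X$, the law of $\mathcal X+\delta_U$ is absolutely continuous with respect to the law of $\mathcal X$. (2) If $\beta\le 1/2$ and $v_0>0$, then $\mathcal X$ is rigid at level $1$. This means that $\mathcal X$ is a simple locally finite point process and that for every bounded open set $D\subseteq\mathbb R$ the following hold. (a) The pair $(\mathcal X,D)$ is strongly tolerant subject to the number of points: almost surely, the conditional distribution of $\mathcal X|_D$ given $\mathcal X|_{D^c}$ and the conditional distribution of $\mathcal X|_D$ given $\mathcal X(D)$ are mutually absolutely continuous (in particular $\mathcal X(D)$ is almost surely determined by $\mathcal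 X|_{D^c}$). (b) For every $m\ge 0$ with $\mathbb P(\mathcal X(D)=m)>0$, the conditional distribution of $\mathcal X|_D$ given $\mathcal X(D)=m$ and the image of Lebesgue measure on $D^m$ under $(x_1,\dots,x_m)\mapsto\sum_{i}\delta_{x_i}$ are mutually absolutely continuous. (3) If $\beta\le 1/2$ and $v_0=0$, so that $\mathcal X$ has a point at $0$ almost surely, then $\mathcal X$ is a simple locally finite point process that satisfies (a) for every bounded open set $D$, and the process $\sum_{k\ne 0}\delta_{k+Z_k}$ of the other points is rigid at level $1$. -/

import Mathlib

open MeasureTheory ProbabilityTheory Set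
open scoped NNReal ENNReal

noncomputable section

/-- A point configuration on `ℝ` is represented by its counting measure, and a random
configuration by a measurable map into `Measure ℝ` (whose `σ`-algebra is generated by the
evaluations `μ ↦ μ B`).
This one is the process of the points `k + Z k`, where `k` runs through the set `S` of labels. -/
def perturbedPoints {Ω : Type*} (S : Set ℤ) (Z : ℤ → Ω → ℝ) (ω : Ω) : Measure ℝ :=
  Measure.sum fun k : S => Measure.dirac (((k : ℤ) : ℝ) + Z k ω)

/-- The counting measure of the points `x 0, …, x (m - 1)`. -/
def pointsMeasure {m : ℕ} (x : Fin m → ℝ) : Measure ℝ :=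
  ∑ i, Measure.dirac (x i)

/-- Simple (locally finite) point process on `ℝ`: almost surely every bounded Borel set contains a
finite number of points, and no point is multiple. -/
structure IsSimplePointProcess {Ω : Type*} [MeasurableSpace Ω] (P : Measure Ω)
    (X : Ω → Measure ℝ) : Prop where
  measurable : Measurable X
  finite_count : ∀ᵐ ω ∂P, ∀ B : Set ℝ, Bornology.IsBounded B → MeasurableSet B →
    ∃ n : ℕ, X ω B = n
  simple : ∀ᵐ ω ∂P, ∀ x : ℝ, X ω {x} ≤ 1

/-- Insertion tolerance of the random configuration `X`: for every Borel set `A` of positive finite Lebesgue measure, if `U` is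
uniform on `A` and independent of `X`, then the law of `X + δ_U` is absolutely continuous with
respect to the law of `X`. -/
def InsertionTolerant {Ω : Type*} [MeasurableSpace Ω] (P : Measure Ω)
    (X : Ω → Measure ℝ) : Prop :=
  Measurable X ∧ ∀ A : Set ℝ, MeasurableSet A → 0 < volume A → volume A < ∞ →
    ((P.map X).prod (cond volume A)).map (fun p => p.1 + Measure.dirac p.2) ≪ P.map X

/-- `κ` is a regular conditional distribution of `Y` given `T`: the law of `(T, Y)` is the
composition of the law of `T` with the Markov kernel `κ`. -/
def IsRegularCondDistrib {Ω E F : Type*} [MeasurableSpace Ω] [MeasurableSpace E]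
    [MeasurableSpace F] (P : Measure Ω) (Y : Ω → F) (T : Ω → E) (κ : Kernel E F) : Prop :=
  IsMarkovKernel κ ∧ P.map (fun ω => (T ω, Y ω)) = (P.map T) ⊗ₘ κ

/-- `(X, D)` is strongly tolerant subject to the statistic `f`: almost surely, the conditional
distribution of `X_D` given `X_{Dᶜ}` and the conditional distribution of `X_D` given `f (X_D)` are
mutually absolutely continuous. -/
def StronglyTolerant {Ω E : Type*} [MeasurableSpace Ω] [MeasurableSpace E] (P : Measure Ω)
    (X : Ω → Measure ℝ) (D : Set ℝ) (f : Measure ℝ → E) : Prop :=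
  ∃ (κ : Kernel (Measure ℝ) (Measure ℝ)) (η : Kernel E (Measure ℝ)),
    IsRegularCondDistrib P (fun ω => (X ω).restrict D) (fun ω => (X ω).restrict Dᶜ) κ ∧
    IsRegularCondDistrib P (fun ω => (X ω).restrict D) (fun ω => f ((X ω).restrict D)) η ∧
    ∀ᵐ ω ∂P,
      κ ((X ω).restrict Dᶜ) ≪ η (f ((X ω).restrict D)) ∧
      η (f ((X ω).restrict D)) ≪ κ ((X ω).restrict Dᶜ)

/-- The number of points of a configuration. -/
def numPoints (μ : Measure ℝ) : ℝ≥0∞ := μ univ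

/-- Rigidity at level `1`: for every bounded open `D`, the pair `(X, D)` is strongly tolerant
subject to the number of points, and, given that this number is `m`, the conditional distribution
of `X_D` is mutually absolutely continuous to (the image on configurations of) Lebesgue measure on
`D ^ m`, for every `m` that has positive probability. -/
structure RigidAtLevelOne {Ω : Type*} [MeasurableSpace Ω] (P : Measure Ω)
    (X : Ω → Measure ℝ) : Prop where
  simplePointProcess : IsSimplePointProcess P X
  stronglyTolerant : ∀ D : Set ℝ, IsOpen D → Bornology.IsBounded D →
    StronglyTolerant P X D numPoints
  lebesgue : ∀ D : Set ℝ, IsOpen D → Bornology.IsBounded D → ∀ m : ℕ,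
    P {ω | numPoints ((X ω).restrict D) = m} ≠ 0 →
      (cond P {ω | numPoints ((X ω).restrict D) = m}).map (fun ω => (X ω).restrict D) ≪
        (volume.restrict (univ.pi fun _ : Fin m => D)).map pointsMeasure ∧
      (volume.restrict (univ.pi fun _ : Fin m => D)).map pointsMeasure ≪
        (cond P {ω | numPoints ((X ω).restrict D) = m}).map (fun ω => (X ω).restrict D)

end

open scoped Topology

-- Everything reduces to the product law `latticeLaw` of the positions k + Z_k, which
-- `configuration` pushes forward to point configurations by forgetting the labels.
--
-- For β > 1/2: a uniform law is dominated by N(1, 1), so the inserted point may be taken to be a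
-- second, independent point with the law of point 1. Moving the labels k ≥ 1 up by one and giving
-- the new point the label 1 does not change the configuration, but replaces the factor N(k, k^(2β))
-- by N(k - 1, (k - 1)^(2β)) for k ≥ 2. The density of the latter with respect to the former has
-- second moment 1 + O(k^(-2) + k^(-2β)). Since 2β > 1, the product of these bounds is finite, and
-- `infinitePi_absolutelyContinuous` applies.
--
-- For β ≤ 1/2 the variance at k ≠ 0 is at most |k|. Evaluated at the point with label k, the cutoff
-- `logCutoff N` has variance O(1 / (|k| log² N)), so the sum over |k| ≤ 2N has variance O(1 / log
-- N). Along a subsequence this sum minus its mean tends to 0 almost surely, while the cutoff tends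
-- to 1 at each of the finitely many points in D. Hence the number of points in D can be read off
-- from the points outside (`exists_configuration_apply_eq`).
--
-- Tolerance comes from a symmetry: redraw each coordinate lying in D from its conditional law in D.
-- This preserves the product law, the outside configuration and the count in D. Given the old
-- positions, the new points in D are independent with laws equivalent to Lebesgue measure on D. So
-- the conditional law of the inside, given either the outside or the count, is a mixture of laws
-- from one equivalence class, fixed by the count (`exists_regularCondDistrib_of_randomization`).
-- When v₀ = 0, the deterministic point at 0 is split off and added back.

lemma MeasureTheory.sq_lintegral_le_lintegral_sq {α : Type*} [MeasurableSpace α] (μ : Measure α)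
    [IsProbabilityMeasure μ] {g : α → ℝ≥0∞} (hg : Measurable g) :
    (∫⁻ x, g x ∂μ) ^ 2 ≤ ∫⁻ x, g x ^ 2 ∂μ := by
  have := ENNReal.lintegral_mul_le_Lp_mul_Lq μ (p := 2) (q := 2)
    Real.HolderConjugate.two_two hg.aemeasurable (g := 1) aemeasurable_const
  simp only [Pi.mul_apply, Pi.one_apply, mul_one, ENNReal.one_rpow, lintegral_const, measure_univ]
    at this
  calc _ ≤ ((∫⁻ a, g a ^ (2:ℝ) ∂μ) ^ (1 / (2:ℝ))) ^ 2 := by gcongr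
    _ = _ := by
      rw [← ENNReal.rpow_natCast, ← ENNReal.rpow_mul]
      simp

-- Absolute continuity of infinite product measures

namespace MeasureTheory.Measure

lemma measurable_update_prod {ι α : Type*} [MeasurableSpace α] [DecidableEq ι] (k : ι) :
    Measurable (fun p : (ι → α) × α => Function.update p.1 k p.2) := by
  rw [measurable_pi_iff]
  intro i
  by_cases h : i = k
  · subst h; simpa using measurable_snd
  · simp only [Function.update_of_ne h]; fun_prop

/-- Resampling one coordinate of an infinite product measure changes the corresponding factor. -/
lemma infinitePi_prod_map_update {ι α : Type*} [MeasurableSpace α] [DecidableEq ι]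
    (μ : ι → Measure α) [∀ i, IsProbabilityMeasure (μ i)] (k : ι) (ρ : Measure α)
    [IsProbabilityMeasure ρ] :
    ((infinitePi μ).prod ρ).map (fun p => Function.update p.1 k p.2)
      = infinitePi (Function.update μ k ρ) := by
  have : ∀ i, IsProbabilityMeasure (Function.update μ k ρ i) := by
    intro i
    by_cases h : i = k
    · subst h; simpa
    · rw [Function.update_of_ne h]; infer_instance
  refine eq_infinitePi _ fun s t ht => ?_
  have hm := measurable_update_prod (α := α) k
  rw [map_apply hm (MeasurableSet.pi s.countable_toSet fun i _ => ht i)]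
  by_cases hk : k ∈ s
  · have : (fun p : (ι → α) × α => Function.update p.1 k p.2) ⁻¹' (Set.pi s t)
        = (Set.pi (s.erase k : Finset ι) t) ×ˢ t k := by
      ext ⟨w, x⟩
      simp only [mem_preimage, Set.mem_pi, Finset.mem_coe, mem_prod, Finset.mem_erase]
      constructor
      · intro h
        refine ⟨fun i hi => ?_, ?_⟩
        · simpa [hi.1] using h i hi.2
        · simpa using h k hk
      · rintro ⟨h1, h2⟩ i hi
        by_cases h : i = k
        · subst h; simpa
        · simpa [h] using h1 i ⟨h, hi⟩
    rw [this, prod_prod, infinitePi_pi _ fun i _ => ht i, ← Finset.mul_prod_erase s _ hk, mul_comm]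
    congr 1
    · simp
    · refine Finset.prod_congr rfl fun i hi => ?_
      rw [Function.update_of_ne (Finset.ne_of_mem_erase hi)]
  · have : (fun p : (ι → α) × α => Function.update p.1 k p.2) ⁻¹' (Set.pi s t)
        = (Set.pi s t) ×ˢ univ := by
      ext ⟨w, x⟩
      simp only [mem_preimage, Set.mem_pi, Finset.mem_coe, mem_prod, mem_univ, and_true]
      refine forall₂_congr fun i hi => ?_
      have : i ≠ k := fun h => hk (h ▸ hi)
      simp [this]
    rw [this, prod_prod, infinitePi_pi _ fun i _ => ht i]
    simp only [measure_univ, mul_one]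
    refine Finset.prod_congr rfl fun i hi => ?_
    have : i ≠ k := fun h => hk (h ▸ hi)
    simp [this]

/-- The second moment bound `(∫ g dν)² ≤ K ∫ g² dμ` tensorizes. -/
lemma sq_lintegral_infinitePi_piecewise_le {ι α : Type*} [MeasurableSpace α] [DecidableEq ι]
    (μ ν : ι → Measure α) [∀ i, IsProbabilityMeasure (μ i)] [∀ i, IsProbabilityMeasure (ν i)]
    (K : ι → ℝ≥0∞)
    (h : ∀ i, ∀ g : α → ℝ≥0∞, Measurable g → (∫⁻ x, g x ∂ν i) ^ 2 ≤ K i * ∫⁻ x, g x ^ 2 ∂μ i)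
    (s : Finset ι) (g : (ι → α) → ℝ≥0∞) (hg : Measurable g) :
    (∫⁻ w, g w ∂infinitePi (s.piecewise ν μ)) ^ 2
      ≤ (∏ i ∈ s, K i) * ∫⁻ w, g w ^ 2 ∂infinitePi μ := by
  have hP : ∀ s : Finset ι, ∀ i, IsProbabilityMeasure (s.piecewise ν μ i) := by
    intro s i
    by_cases hi : i ∈ s <;> simp [hi] <;> infer_instance
  induction s using Finset.induction_on generalizing g with
  | empty =>
    simp only [Finset.piecewise_empty, Finset.prod_empty, one_mul]
    exact sq_lintegral_le_lintegral_sq _ hg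
  | insert k s hk ih =>
    have hupd : (insert k s).piecewise ν μ = Function.update (s.piecewise ν μ) k (ν k) :=
      Finset.piecewise_insert s ν μ k
    have hm := measurable_update_prod (α := α) k
    have h1 : ∫⁻ w, g w ∂infinitePi ((insert k s).piecewise ν μ)
        = ∫⁻ w, (∫⁻ x, g (Function.update w k x) ∂ν k) ∂infinitePi (s.piecewise ν μ) := by
      rw [hupd, ← infinitePi_prod_map_update, lintegral_map hg hm]
      exact lintegral_prod _ (hg.comp hm).aemeasurable
    have h2 : ∫⁻ w, g w ^ 2 ∂infinitePi μ
        = ∫⁻ w, (∫⁻ x, g (Function.update w k x) ^ 2 ∂μ k) ∂infinitePi μ := by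
      conv_lhs => rw [← Function.update_eq_self k μ]
      rw [← infinitePi_prod_map_update, lintegral_map (hg.pow_const 2) hm]
      exact lintegral_prod _ ((hg.pow_const 2).comp hm).aemeasurable
    rw [h1, h2, Finset.prod_insert hk]
    have hmeas' : Measurable fun w => ∫⁻ x, g (Function.update w k x) ^ 2 ∂μ k :=
      Measurable.lintegral_prod_right' ((hg.pow_const 2).comp hm)
    have hmeas : Measurable fun w => ∫⁻ x, g (Function.update w k x) ∂ν k :=
      Measurable.lintegral_prod_right' (hg.comp hm)
    -- The induction hypothesis is applied to `g` with coordinate `k` integrated out against `ν k`;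
    -- the one-coordinate bound is then used inside the integral.
    refine (ih _ hmeas).trans ?_
    calc _ ≤ (∏ i ∈ s, K i) * ∫⁻ w, K k * (∫⁻ x, g (Function.update w k x) ^ 2 ∂μ k)
            ∂infinitePi μ := by
          gcongr with w
          exact h k _ (hg.comp (measurable_update w))
      _ = _ := by
          rw [lintegral_const_mul _ hmeas']
          ring

open scoped symmDiff in
/-- A sufficient condition for absolute continuity of infinite product measures (compare
Kakutani's theorem): the densities have second moments with bounded finite products. -/
theorem infinitePi_absolutelyContinuous {ι α : Type*} [MeasurableSpace α]
    (μ ν : ι → Measure α) [∀ i, IsProbabilityMeasure (μ i)] [∀ i, IsProbabilityMeasure (ν i)]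
    (K : ι → ℝ≥0∞)
    (h : ∀ i, ∀ g : α → ℝ≥0∞, Measurable g → (∫⁻ x, g x ∂ν i) ^ 2 ≤ K i * ∫⁻ x, g x ^ 2 ∂μ i)
    (C : ℝ≥0∞) (hC : C ≠ ∞) (hK : ∀ s : Finset ι, ∏ i ∈ s, K i ≤ C) :
    infinitePi ν ≪ infinitePi μ := by
  classical
  have hP : ∀ s : Finset ι, ∀ i, IsProbabilityMeasure (s.piecewise ν μ i) := by
    intro s i
    by_cases hi : i ∈ s <;> simp [hi] <;> infer_instance
  have hcyl : ∀ A ∈ measurableCylinders (fun _ : ι => α),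
      (infinitePi ν A) ^ 2 ≤ C * infinitePi μ A := by
    intro A hA
    have hAm : MeasurableSet A := MeasurableSet.of_mem_measurableCylinders hA
    obtain ⟨s, B, hB, rfl⟩ := (mem_measurableCylinders A).1 hA
    -- A cylinder over `s` does not see the factors outside `s`, so only finitely many factors need
    -- to be exchanged.
    have h1 : infinitePi ν (cylinder s B) = infinitePi (s.piecewise ν μ) (cylinder s B) := by
      rw [infinitePi_cylinder _ hB, infinitePi_cylinder _ hB]
      congr 2
      funext i
      simp
    have h2 := sq_lintegral_infinitePi_piecewise_le μ ν K h s
      ((cylinder s B).indicator 1) (measurable_one.indicator hAm)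
    have h3 : ∀ w, ((cylinder s B).indicator (1 : (ι → α) → ℝ≥0∞) w) ^ 2
        = (cylinder s B).indicator 1 w := by
      intro w
      by_cases hw : w ∈ cylinder s B <;> simp [Set.indicator, hw]
    simp only [h3] at h2
    rw [lintegral_indicator_one hAm, lintegral_indicator_one hAm, ← h1] at h2
    exact h2.trans (by gcongr; exact hK s)
  have halg : IsSetAlgebra (measurableCylinders (fun _ : ι => α)) :=
    ⟨empty_mem_measurableCylinders _, fun _ hs => compl_mem_measurableCylinders hs,
      fun _ _ hs ht => union_mem_measurableCylinders hs ht⟩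
  -- Density is taken for the sum of the two measures, so that one cylinder approximates `A` under
  -- both at once.
  have hdense := MeasureDense.of_generateFrom_isSetAlgebra_finite (infinitePi μ + infinitePi ν)
    halg generateFrom_measurableCylinders.symm
  refine AbsolutelyContinuous.mk fun A hA hA0 => ?_
  have key : ∀ ε : ℝ≥0, 0 < ε → infinitePi ν A ≤ ε + (C * ε) ^ (1 / 2 : ℝ) := by
    intro ε hε
    obtain ⟨t, ht, hlt⟩ := hdense.approx A hA (measure_ne_top _ _) ε (by exact_mod_cast hε)
    rw [ENNReal.ofReal_coe_nnreal, add_apply] at hlt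
    have hμt : infinitePi μ t ≤ ε := by
      calc infinitePi μ t ≤ infinitePi μ (A ∪ A ∆ t) := by
            refine measure_mono fun x hx => ?_
            by_cases hxA : x ∈ A
            · exact Or.inl hxA
            · exact Or.inr (Or.inr ⟨hx, hxA⟩)
        _ ≤ infinitePi μ A + infinitePi μ (A ∆ t) := measure_union_le _ _
        _ ≤ ε := by rw [hA0, zero_add]; exact le_self_add.trans hlt.le
    have hνt : infinitePi ν t ≤ (C * ε) ^ (1 / 2 : ℝ) := by
      rw [one_div, ENNReal.le_rpow_inv_iff (by norm_num), ENNReal.rpow_two]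
      exact (hcyl t ht).trans (by gcongr)
    calc infinitePi ν A ≤ infinitePi ν (A ∆ t ∪ t) := by
            refine measure_mono fun x hx => ?_
            by_cases hxt : x ∈ t
            · exact Or.inr hxt
            · exact Or.inl (Or.inl ⟨hx, hxt⟩)
      _ ≤ infinitePi ν (A ∆ t) + infinitePi ν t := measure_union_le _ _
      _ ≤ _ := add_le_add (le_add_self.trans hlt.le) hνt
  have hlim : Filter.Tendsto (fun n : ℕ => ((((n : ℝ≥0) + 1)⁻¹ : ℝ≥0) : ℝ≥0∞)
      + (C * (((n : ℝ≥0) + 1)⁻¹ : ℝ≥0)) ^ (1 / 2 : ℝ)) Filter.atTop (nhds 0) := by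
    have h0 : Filter.Tendsto (fun n : ℕ => ((((n : ℝ≥0) + 1)⁻¹ : ℝ≥0) : ℝ≥0∞))
        Filter.atTop (nhds 0) := by
      have := ENNReal.tendsto_inv_nat_nhds_zero.comp (Filter.tendsto_add_atTop_nat 1)
      refine this.congr fun n => ?_
      simp [ENNReal.coe_inv]
    have h1 := ENNReal.Tendsto.const_mul (a := C) h0 (Or.inr hC)
    have h2 := (ENNReal.continuous_rpow_const (y := 1 / 2)).tendsto _ |>.comp h1
    simpa using h0.add h2
  exact le_antisymm (ge_of_tendsto' hlim fun n => key _ (by positivity)) zero_le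

end MeasureTheory.Measure

-- Second moments of Gaussian densities

namespace ProbabilityTheory

/-- The square of a Gaussian density is the product of a second Gaussian density of at least half
the variance, of a third one, and of a constant. -/
lemma gaussianPDFReal_sq_eq (m₁ m₂ : ℝ) {s t : ℝ≥0} (hs : 0 < s) (hst : s ≤ t) (x : ℝ) :
    gaussianPDFReal m₁ s x ^ 2 = gaussianPDFReal m₂ t x *
      ((√((t : ℝ) ^ 2 / (s * (2 * t - s))) * Real.exp ((m₁ - m₂) ^ 2 / (2 * t - s))) *
        gaussianPDFReal ((2 * t * m₁ - s * m₂) / (2 * t - s)) (s * t / (2 * t - s)) x) := by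
  have hs' : (0 : ℝ) < s := by exact_mod_cast hs
  have hst' : (s : ℝ) ≤ t := by exact_mod_cast hst
  have hd : (0 : ℝ) < 2 * t - s := by linarith
  have ht' : (0 : ℝ) < t := by linarith
  -- The subtraction in `ℝ≥0` is truncated; it is a genuine one because s ≤ t.
  have hc : ((s * t / (2 * t - s) : ℝ≥0) : ℝ) = s * t / (2 * t - s) := by
    rw [NNReal.coe_div, NNReal.coe_sub (by calc s ≤ t := hst
      _ ≤ 2 * t := by rw [two_mul]; exact le_self_add)]
    simp
  simp only [gaussianPDFReal, hc]
  have hexp : Real.exp (-(x - m₁) ^ 2 / (2 * s)) ^ 2 = Real.exp (-(x - m₂) ^ 2 / (2 * t)) *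
      (Real.exp ((m₁ - m₂) ^ 2 / (2 * t - s)) *
      Real.exp (-(x - (2 * t * m₁ - s * m₂) / (2 * t - s)) ^ 2 / (2 * (s * t / (2 * t - s))))) := by
    rw [← Real.exp_add, ← Real.exp_add, ← Real.exp_nat_mul]
    congr 1
    field_simp
    push_cast
    ring
  have hpre : ((√(2 * Real.pi * s))⁻¹) ^ 2 = (√(2 * Real.pi * t))⁻¹ *
      (√((t : ℝ) ^ 2 / (s * (2 * t - s))) * (√(2 * Real.pi * (s * t / (2 * t - s))))⁻¹) := by
    have hpi := Real.pi_pos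
    rw [← Real.sqrt_inv, ← Real.sqrt_inv, ← Real.sqrt_inv, Real.sq_sqrt (by positivity),
      ← Real.sqrt_mul (by positivity), ← Real.sqrt_mul (by positivity)]
    symm
    rw [Real.sqrt_eq_iff_mul_self_eq (by positivity) (by positivity)]
    field_simp
  rw [mul_pow, hexp, hpre]
  ring

/-- Cauchy–Schwarz for `g` times the density of N(m₁, s), whose square factors by
`gaussianPDFReal_sq_eq`. The constant is the second moment of the density of N(m₁, s) with respect
to N(m₂, t), since the third Gaussian integrates to 1. -/
lemma sq_lintegral_gaussianReal_le (m₁ m₂ : ℝ) {s t : ℝ≥0} (hs : 0 < s) (hst : s ≤ t)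
    {g : ℝ → ℝ≥0∞} (hg : Measurable g) :
    (∫⁻ x, g x ∂gaussianReal m₁ s) ^ 2 ≤
      ENNReal.ofReal (√((t : ℝ) ^ 2 / (s * (2 * t - s))) * Real.exp ((m₁ - m₂) ^ 2 / (2 * t - s)))
        * ∫⁻ x, g x ^ 2 ∂gaussianReal m₂ t := by
  have ht : 0 < t := hs.trans_le hst
  set K := √((t : ℝ) ^ 2 / (s * (2 * t - s))) * Real.exp ((m₁ - m₂) ^ 2 / (2 * t - s)) with hK
  have hK0 : 0 ≤ K := by positivity
  set m := (2 * t * m₁ - s * m₂) / (2 * t - s)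
  set v : ℝ≥0 := s * t / (2 * t - s)
  have hv : v ≠ 0 := by
    have : 0 < 2 * t - s := by
      rw [tsub_pos_iff_lt]
      calc s ≤ t := hst
        _ < 2 * t := by rw [two_mul]; exact lt_add_of_pos_right t ht
    positivity
  have hmul : ∀ x, gaussianPDF m₁ s x = gaussianPDF m₂ t x ^ (1 / 2 : ℝ) *
      (ENNReal.ofReal K * gaussianPDF m v x) ^ (1 / 2 : ℝ) := by
    intro x
    rw [← ENNReal.mul_rpow_of_nonneg _ _ (by norm_num)]
    simp only [gaussianPDF]
    rw [← ENNReal.ofReal_mul hK0, ← ENNReal.ofReal_mul (gaussianPDFReal_nonneg _ _ _),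
      ← gaussianPDFReal_sq_eq m₁ m₂ hs hst x, ENNReal.ofReal_pow (gaussianPDFReal_nonneg _ _ _),
      ← ENNReal.rpow_two, ← ENNReal.rpow_mul]
    norm_num
  rw [gaussianReal_of_var_ne_zero _ hs.ne', gaussianReal_of_var_ne_zero _ ht.ne',
    lintegral_withDensity_eq_lintegral_mul _ (measurable_gaussianPDF _ _) hg,
    lintegral_withDensity_eq_lintegral_mul _ (measurable_gaussianPDF _ _) (hg.pow_const 2)]
  have h1 := ENNReal.lintegral_mul_le_Lp_mul_Lq volume (p := 2) (q := 2)
    Real.HolderConjugate.two_two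
    (f := fun x => g x * gaussianPDF m₂ t x ^ (1 / 2 : ℝ))
    (g := fun x => (ENNReal.ofReal K * gaussianPDF m v x) ^ (1 / 2 : ℝ))
    (hg.mul ((measurable_gaussianPDF _ _).pow_const _)).aemeasurable
    (((measurable_gaussianPDF _ _).const_mul _).pow_const _).aemeasurable
  have hsq : ∀ a : ℝ≥0∞, (a ^ (1 / 2 : ℝ)) ^ (2 : ℝ) = a := by
    intro a
    rw [← ENNReal.rpow_mul]; norm_num
  simp only [ENNReal.mul_rpow_of_nonneg _ _ (show (0 : ℝ) ≤ 2 by norm_num), hsq,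
    Pi.mul_apply] at h1
  rw [lintegral_const_mul _ (measurable_gaussianPDF _ _), lintegral_gaussianPDF_eq_one _ hv,
    mul_one] at h1
  calc _ = (∫⁻ x, g x * gaussianPDF m₂ t x ^ (1 / 2 : ℝ) *
        (ENNReal.ofReal K * gaussianPDF m v x) ^ (1 / 2 : ℝ)) ^ 2 := by
        congr 2
        funext x
        rw [Pi.mul_apply, hmul x]
        ring
    _ ≤ _ := pow_le_pow_left₀ zero_le h1 2
    _ = _ := by
      rw [← ENNReal.rpow_two, ENNReal.mul_rpow_of_nonneg _ _ (show (0 : ℝ) ≤ 2 by norm_num), hsq,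
        hsq, mul_comm]
      congr 2
      funext x
      simp [mul_comm]

end ProbabilityTheory

/-- The second moment of the density of `N(x - 1, (x - 1) ^ p)` with respect to `N(x, x ^ p)` is
close to one. -/
lemma sqrt_mul_exp_shift_le {p x : ℝ} (hp : 1 ≤ p) (hx : 2 ≤ x) :
    √((x ^ p) ^ 2 / ((x - 1) ^ p * (2 * x ^ p - (x - 1) ^ p)))
        * Real.exp ((x - 1 - x) ^ 2 / (2 * x ^ p - (x - 1) ^ p))
      ≤ Real.exp (2 ^ p * p ^ 2 * x ^ (-2 : ℝ) + x ^ (-p)) := by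
  have hx0 : 0 < x := by linarith
  have hs : 0 < (x - 1) ^ p := Real.rpow_pos_of_pos (by linarith) p
  have ht : 0 < x ^ p := Real.rpow_pos_of_pos hx0 p
  have hst : (x - 1) ^ p ≤ x ^ p := Real.rpow_le_rpow (by linarith) (by linarith) (by linarith)
  set r := (x - 1) ^ p / x ^ p with hr
  have hrx : r = (1 + -(1 / x)) ^ p := by
    rw [hr, ← Real.div_rpow (by linarith) hx0.le]
    congr 1
    field_simp
    ring
  have hr1 : r ≤ 1 := (div_le_one ht).2 hst
  have hrp : 1 - p / x ≤ r := by
    have h1x : 1 / x ≤ 1 := by rw [div_le_one hx0]; linarith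
    have := one_add_mul_self_le_rpow_one_add (s := -(1 / x)) (by linarith) hp
    rw [hrx]
    calc _ = 1 + p * -(1 / x) := by ring
      _ ≤ _ := this
  have hr2 : (2 ^ p)⁻¹ ≤ r := by
    rw [hrx, ← Real.inv_rpow (by norm_num)]
    refine Real.rpow_le_rpow (by norm_num) ?_ (by linarith)
    have : 1 / x ≤ 1 / 2 := one_div_le_one_div_of_le (by norm_num) hx
    norm_num at this ⊢
    linarith
  have h2p : (0 : ℝ) < 2 ^ p := Real.rpow_pos_of_pos (by norm_num) p
  have hr0 : 0 < r := lt_of_lt_of_le (by positivity) hr2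
  have hsr : (x - 1) ^ p = r * x ^ p := by rw [hr]; field_simp
  rw [hsr]
  have e1 : (x ^ p) ^ 2 / (r * x ^ p * (2 * x ^ p - r * x ^ p)) = 1 / (r * (2 - r)) := by
    have : 0 < 2 - r := by linarith
    have h3 : 2 * x ^ p - r * x ^ p = (2 - r) * x ^ p := by ring
    rw [h3]
    field_simp
  rw [e1, Real.exp_add]
  have hy : 0 < r * (2 - r) := mul_pos hr0 (by linarith)
  gcongr
  · rw [Real.sqrt_le_left (Real.exp_pos _).le, ← Real.exp_nat_mul]
    have h4 : 1 / (r * (2 - r)) - 1 ≤ ((2 : ℕ) : ℝ) * (2 ^ p * p ^ 2 * x ^ (-2 : ℝ)) := by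
      have h5 : 1 / (r * (2 - r)) - 1 = (1 - r) ^ 2 * (1 / (r * (2 - r))) := by
        have : 2 - r ≠ 0 := by linarith
        field_simp
        ring
      have h6 : 1 / (r * (2 - r)) ≤ 2 ^ p := by
        rw [div_le_iff₀ hy]
        have h7 : 1 ≤ 2 ^ p * r := by
          have := mul_le_mul_of_nonneg_left hr2 h2p.le
          rwa [mul_inv_cancel₀ h2p.ne'] at this
        nlinarith [mul_nonneg (mul_nonneg h2p.le hr0.le) (sub_nonneg.2 hr1)]
      have h8 : (1 - r) ^ 2 ≤ (p / x) ^ 2 :=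
        pow_le_pow_left₀ (by linarith) (by linarith) 2
      rw [h5]
      calc (1 - r) ^ 2 * (1 / (r * (2 - r))) ≤ (p / x) ^ 2 * 2 ^ p := by gcongr
        _ = 2 ^ p * p ^ 2 * x ^ (-2 : ℝ) := by
          rw [Real.rpow_neg hx0.le, Real.rpow_two]
          field_simp
        _ ≤ _ := by
          push_cast
          have : 0 ≤ 2 ^ p * p ^ 2 * x ^ (-2 : ℝ) := by positivity
          linarith
    calc 1 / (r * (2 - r)) = (1 / (r * (2 - r)) - 1) + 1 := by ring
      _ ≤ Real.exp (1 / (r * (2 - r)) - 1) := Real.add_one_le_exp _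
      _ ≤ _ := Real.exp_le_exp.2 h4
  · rw [Real.rpow_neg hx0.le]
    have : (x - 1 - x) ^ 2 = 1 := by ring
    rw [this, one_div]
    refine inv_anti₀ ht ?_
    nlinarith

-- Configurations, relabelling and insertion tolerance

/-- The counting measure of the points `w k`, where `k` runs through `S`. -/
noncomputable def configuration (S : Set ℤ) (w : ℤ → ℝ) : Measure ℝ :=
  Measure.sum fun k : S => Measure.dirac (w k)

lemma measurable_configuration (S : Set ℤ) : Measurable (configuration S) := by
  refine Measure.measurable_of_measurable_coe _ fun B hB => ?_
  simp only [configuration, Measure.sum_apply _ hB]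
  refine Measurable.tsum fun k => ?_
  exact (Measure.measurable_coe hB).comp (Measure.measurable_dirac.comp (measurable_pi_apply _))

/-- The law of the perturbed lattice `k + Z k`, where `Z k` has law `N(0, v k)`. -/
noncomputable def latticeLaw (v : ℤ → ℝ≥0) : Measure (ℤ → ℝ) :=
  Measure.infinitePi fun k => gaussianReal k (v k)

instance (v : ℤ → ℝ≥0) : IsProbabilityMeasure (latticeLaw v) := by
  unfold latticeLaw; infer_instance

lemma map_perturbed_eq_latticeLaw {Ω : Type*} [MeasurableSpace Ω] {P : Measure Ω}
    [IsProbabilityMeasure P] {Z : ℤ → Ω → ℝ} (hZ : ∀ k, Measurable (Z k)) (hindep : iIndepFun Z P)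
    {v : ℤ → ℝ≥0} (hlaw : ∀ k, P.map (Z k) = gaussianReal 0 (v k)) :
    P.map (fun ω (k : ℤ) => (k : ℝ) + Z k ω) = latticeLaw v := by
  have h := hindep.comp (fun (k : ℤ) x => (k : ℝ) + x) (fun k => measurable_const_add _)
  have := h.map_fun_eq_infinitePi_map fun k => (measurable_const_add _).comp (hZ k)
  rw [latticeLaw]
  refine this.trans ?_
  congr 1
  funext k
  rw [← Measure.map_map (measurable_const_add _) (hZ k), hlaw, gaussianReal_map_const_add, zero_add]

/-- The shift of the labels `≥ 1` by one, which leaves the label `1` free. -/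
def shiftLabel (k : ℤ) : ℤ := if k ≤ 0 then k else k + 1

lemma shiftLabel_injective : Function.Injective shiftLabel := by
  intro a b h
  unfold shiftLabel at h
  split_ifs at h <;> omega

lemma shiftLabel_ne_one (k : ℤ) : shiftLabel k ≠ 1 := by
  unfold shiftLabel
  split_ifs <;> omega

/-- The left inverse of `shiftLabel`, which sends the free label `1` to itself. -/
def unshiftLabel (k : ℤ) : ℤ := if k ≤ 1 then k else k - 1

lemma unshiftLabel_shiftLabel (k : ℤ) : unshiftLabel (shiftLabel k) = k := by
  unfold shiftLabel unshiftLabel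
  split_ifs <;> omega

lemma configuration_comp_shiftLabel_add_dirac (w : ℤ → ℝ) :
    configuration univ (w ∘ shiftLabel) + Measure.dirac (w 1) = configuration univ w := by
  have hr : range shiftLabel = {1}ᶜ := by
    ext k
    simp only [mem_range, mem_compl_iff, mem_singleton_iff]
    constructor
    · rintro ⟨j, rfl⟩
      exact shiftLabel_ne_one j
    · intro h
      refine ⟨unshiftLabel k, ?_⟩
      unfold shiftLabel unshiftLabel
      split_ifs <;> omega
  refine Measure.ext fun B hB => ?_
  simp only [configuration, Measure.add_apply, Measure.sum_apply _ hB]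
  rw [tsum_univ (fun k : ℤ => Measure.dirac (w k) B),
    tsum_univ (fun k : ℤ => Measure.dirac ((w ∘ shiftLabel) k) B)]
  have h1 : ∑' k, Measure.dirac ((w ∘ shiftLabel) k) B
      = ∑' k : ({1}ᶜ : Set ℤ), Measure.dirac (w k) B := by
    rw [← hr]
    exact (tsum_range (fun k => Measure.dirac (w k) B) shiftLabel_injective).symm
  rw [h1, add_comm, ← tsum_singleton (1 : ℤ) fun k => Measure.dirac (w k) B]
  exact Summable.tsum_add_tsum_compl (f := fun k => Measure.dirac (w k) B) (s := {1})
    ENNReal.summable ENNReal.summable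

/-- A configuration does not remember labels: the independent extra point can occupy the label 1
that `shiftLabel` leaves free. In the relabelled product both labels 1 and 2 carry `μ 1`. -/
lemma prod_map_configuration_add_dirac (μ : ℤ → Measure ℝ) [∀ k, IsProbabilityMeasure (μ k)] :
    ((Measure.infinitePi μ).prod (μ 1)).map
        (fun p => configuration univ p.1 + Measure.dirac p.2)
      = (Measure.infinitePi fun k => μ (unshiftLabel k)).map (configuration univ) := by
  set M' := Measure.infinitePi fun k => μ (unshiftLabel k) with hM'
  have hμ1 : μ (unshiftLabel 1) = μ 1 := rfl
  have h1 : M'.map (fun w => w ∘ shiftLabel) = Measure.infinitePi μ := by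
    have := Measure.map_infinitePi_infinitePi_of_inj (P := fun k => μ (unshiftLabel k))
      shiftLabel_injective
    simp only [unshiftLabel_shiftLabel] at this
    exact this
  have hcomp : Measurable fun w : ℤ → ℝ => w ∘ shiftLabel := by
    rw [measurable_pi_iff]; intro k; exact measurable_pi_apply _
  have h2 : (M'.prod (μ 1)).map (fun p => Function.update p.1 1 p.2) = M' := by
    rw [hM', Measure.infinitePi_prod_map_update]
    congr 1
    conv_rhs => rw [← Function.update_eq_self 1 fun k => μ (unshiftLabel k)]
    rfl
  have hadd : Measurable fun p : (ℤ → ℝ) × ℝ => configuration univ p.1 + Measure.dirac p.2 :=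
    ((measurable_configuration univ).comp measurable_fst).add
      (Measure.measurable_dirac.comp measurable_snd)
  conv_rhs => rw [← h2]
  rw [Measure.map_map (measurable_configuration _) (Measure.measurable_update_prod 1), ← h1]
  conv_lhs => rw [← Measure.map_id (μ := μ 1)]
  rw [Measure.map_prod_map _ _ hcomp measurable_id,
    Measure.map_map hadd (hcomp.prodMap measurable_id)]
  congr 1
  funext p
  simp only [Function.comp_apply, Prod.map]
  rw [← configuration_comp_shiftLabel_add_dirac (Function.update p.1 1 p.2)]
  congr 2
  funext k
  simp [Function.update_of_ne (shiftLabel_ne_one k)]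

/-- The logarithms of the second moment bounds are dominated by `b`, which is summable exactly
because p > 1; this is where the threshold β = 1/2 enters. -/
lemma latticeLaw_unshift_absolutelyContinuous {p : ℝ} (hp : 1 < p) {v : ℤ → ℝ≥0}
    (hv : ∀ k, k ≠ 0 → v k = (k.natAbs : ℝ≥0) ^ p) :
    (Measure.infinitePi fun k : ℤ => gaussianReal (unshiftLabel k : ℤ) (v (unshiftLabel k)))
      ≪ latticeLaw v := by
  classical
  have hvk : ∀ k : ℤ, 0 < k → (v k : ℝ) = (k : ℝ) ^ p := by
    intro k hk
    rw [hv k hk.ne', NNReal.coe_rpow, NNReal.coe_natCast, Nat.cast_natAbs, abs_of_pos hk]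
  set b : ℤ → ℝ := fun k => 2 ^ p * p ^ 2 * |(k : ℝ)| ^ (-2 : ℝ) + |(k : ℝ)| ^ (-p) with hb
  have hb0 : ∀ k, 0 ≤ b k := fun k => by positivity
  have hbs : Summable b :=
    ((Real.summable_abs_int_rpow (by norm_num)).mul_left _).add (Real.summable_abs_int_rpow hp)
  refine Measure.infinitePi_absolutelyContinuous _ _ (fun k => ENNReal.ofReal (Real.exp (b k)))
    ?_ (ENNReal.ofReal (Real.exp (∑' k, b k))) ENNReal.ofReal_ne_top ?_
  · intro k g hg
    -- The factors with k ≤ 1 are unchanged, and `b k ≥ 0` is all that is needed there. From k = 2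
    -- on, the old variance is at most the new one.
    by_cases hk : k ≤ 1
    · have : unshiftLabel k = k := by simp [unshiftLabel, hk]
      rw [this]
      refine (sq_lintegral_le_lintegral_sq _ hg).trans (le_mul_of_one_le_left zero_le ?_)
      rw [ENNReal.one_le_ofReal]
      exact Real.one_le_exp (hb0 k)
    · have hk2 : 2 ≤ k := by omega
      have hk2' : (2 : ℝ) ≤ k := by exact_mod_cast hk2
      have : unshiftLabel k = k - 1 := by simp [unshiftLabel, hk]
      rw [this]
      have hs : (v (k - 1) : ℝ) = ((k : ℝ) - 1) ^ p := by
        rw [hvk _ (by omega)]; push_cast; rfl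
      have ht : (v k : ℝ) = (k : ℝ) ^ p := hvk _ (by omega)
      have hs0 : 0 < v (k - 1) := by
        rw [← NNReal.coe_pos, hs]
        exact Real.rpow_pos_of_pos (by linarith) _
      have hst : v (k - 1) ≤ v k := by
        rw [← NNReal.coe_le_coe, hs, ht]
        exact Real.rpow_le_rpow (by linarith) (by linarith) (by linarith)
      refine (sq_lintegral_gaussianReal_le _ k hs0 hst hg).trans ?_
      gcongr
      have := sqrt_mul_exp_shift_le hp.le hk2'
      rw [hs, ht]
      push_cast
      simp only [hb]
      rwa [abs_of_pos (by linarith)]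
  · intro s
    rw [← ENNReal.ofReal_prod_of_nonneg fun k _ => (Real.exp_pos _).le, ← Real.exp_sum]
    exact ENNReal.ofReal_le_ofReal (Real.exp_le_exp.2 (hbs.sum_le_tsum s fun k _ => hb0 k))

theorem insertionTolerant_perturbedPoints {Ω : Type*} [MeasurableSpace Ω] {P : Measure Ω}
    [IsProbabilityMeasure P] {Z : ℤ → Ω → ℝ} (hZ : ∀ k, Measurable (Z k)) (hindep : iIndepFun Z P)
    {v : ℤ → ℝ≥0} (hlaw : ∀ k, P.map (Z k) = gaussianReal 0 (v k)) {p : ℝ} (hp : 1 < p)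
    (hv : ∀ k, k ≠ 0 → v k = (k.natAbs : ℝ≥0) ^ p) :
    InsertionTolerant P (perturbedPoints univ Z) := by
  have hW : Measurable fun ω (k : ℤ) => (k : ℝ) + Z k ω :=
    measurable_pi_iff.2 fun k => (hZ k).const_add _
  have hX : perturbedPoints univ Z = configuration univ ∘ fun ω (k : ℤ) => (k : ℝ) + Z k ω := rfl
  refine ⟨hX ▸ (measurable_configuration _).comp hW, fun A hA hA0 hAtop => ?_⟩
  have hmap : P.map (perturbedPoints univ Z) = (latticeLaw v).map (configuration univ) := by
    rw [hX, ← Measure.map_map (measurable_configuration _) hW,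
      map_perturbed_eq_latticeLaw hZ hindep hlaw]
  have hadd : Measurable fun p : (ℤ → ℝ) × ℝ => configuration univ p.1 + Measure.dirac p.2 :=
    ((measurable_configuration univ).comp measurable_fst).add
      (Measure.measurable_dirac.comp measurable_snd)
  have hadd' : Measurable fun p : Measure ℝ × ℝ => p.1 + Measure.dirac p.2 :=
    measurable_fst.add (Measure.measurable_dirac.comp measurable_snd)
  have hv1 : v 1 ≠ 0 := by rw [hv 1 one_ne_zero]; simp
  have hU : cond volume A ≪ gaussianReal 1 (v 1) :=
    cond_absolutelyContinuous.trans (gaussianReal_absolutelyContinuous' 1 hv1)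
  have := cond_isProbabilityMeasure_of_finite hA0.ne' hAtop.ne
  rw [hmap]
  have e : ((latticeLaw v).map (configuration univ)).prod (cond volume A)
      = ((latticeLaw v).prod (cond volume A)).map (Prod.map (configuration univ) id) := by
    conv_lhs => rw [← Measure.map_id (μ := cond volume A)]
    rw [Measure.map_prod_map _ _ (measurable_configuration _) measurable_id]
  rw [e, Measure.map_map hadd' ((measurable_configuration _).prodMap measurable_id)]
  refine ((Measure.AbsolutelyContinuous.rfl.prod hU).map hadd).trans ?_
  have h := prod_map_configuration_add_dirac fun k : ℤ => gaussianReal k (v k)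
  rw [Int.cast_one] at h
  rw [latticeLaw, h]
  exact (latticeLaw_unshift_absolutelyContinuous hp hv).map (measurable_configuration _)

-- Conditional laws from an invariant randomization

/-- Suppose that a law `M` is invariant under a randomization `Φ` (with randomness `Q`) that leaves
the statistic `Y` unchanged, and that, for almost every state `w`, the law of `X` after the
randomization of `w` is equivalent to `Λ (n w)`, where `n w` is a function of `Y w`. Then the
conditional law of `X` given `Y` is almost surely equivalent to `Λ (n w)`. -/
theorem exists_regularCondDistrib_of_randomization {α γ E F : Type*} [MeasurableSpace α]
    [StandardBorelSpace α] [Nonempty α] [MeasurableSpace γ] [MeasurableSpace E] [MeasurableSpace F]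
    (M : Measure α) [IsProbabilityMeasure M] (Q : Measure γ) [IsProbabilityMeasure Q]
    {Φ : α × γ → α} (hΦ : Measurable Φ) (hinv : (M.prod Q).map Φ = M)
    {Y : α → E} (hY : Measurable Y) (hYinv : ∀ᵐ p ∂M.prod Q, Y (Φ p) = Y p.1)
    {X : α → F} (hX : Measurable X)
    {n : α → ℝ≥0∞} (hn : Measurable n) {g : E → ℝ≥0∞} (hg : Measurable g)
    (hng : ∀ᵐ w ∂M, n w = g (Y w)) (Λ : ℝ≥0∞ → Measure F)
    (hΛ : ∀ᵐ w ∂M, Q.map (fun u => X (Φ (w, u))) ≪ Λ (n w) ∧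
      Λ (n w) ≪ Q.map (fun u => X (Φ (w, u)))) :
    ∃ κ : Kernel E F, IsRegularCondDistrib M X Y κ ∧
      ∀ᵐ w ∂M, κ (Y w) ≪ Λ (n w) ∧ Λ (n w) ≪ κ (Y w) := by
  set ν : Kernel E α := condDistrib id Y M with hν
  have hXΦ : Measurable fun p => X (Φ p) := hX.comp hΦ
  set L : Kernel α F := (Kernel.id ×ₖ Kernel.const α Q).map fun p => X (Φ p) with hL
  have hLm : IsMarkovKernel L := Kernel.IsMarkovKernel.map _ hXΦ
  have hLw : ∀ w, L w = Q.map fun u => X (Φ (w, u)) := by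
    intro w
    rw [hL, Kernel.map_apply _ hXΦ, Kernel.prod_apply, Kernel.id_apply, Kernel.const_apply,
      Measure.dirac_prod, Measure.map_map hXΦ measurable_prodMk_left]
    rfl
  have hνM : (M.map Y) ⊗ₘ ν = M.map fun w => (Y w, w) := compProd_map_condDistrib aemeasurable_id
  have hYw : Measurable fun w => (Y w, w) := hY.prodMk measurable_id
  -- The kernel draws a state from its conditional law given `Y` and then randomizes it; invariance
  -- makes this another version of the conditional law of `X`.
  refine ⟨L ∘ₖ ν, ⟨inferInstance, ?_⟩, ?_⟩
  · have : IsProbabilityMeasure (M.map Y) := Measure.isProbabilityMeasure_map hY.aemeasurable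
    have : IsProbabilityMeasure (M.map fun w => (Y w, X w)) :=
      Measure.isProbabilityMeasure_map (hY.prodMk hX).aemeasurable
    refine Measure.ext_prod fun {A B} hA hB => ?_
    rw [Measure.compProd_apply_prod hA hB, Measure.map_apply (hY.prodMk hX) (hA.prod hB)]
    have hS : MeasurableSet {p : α × γ | Y p.1 ∈ A ∧ X (Φ p) ∈ B} :=
      ((hY.comp measurable_fst) hA).inter (hXΦ hB)
    have h1 : M ((fun w => (Y w, X w)) ⁻¹' A ×ˢ B)
        = M.prod Q {p | Y p.1 ∈ A ∧ X (Φ p) ∈ B} := by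
      conv_lhs => rw [← hinv]
      rw [Measure.map_apply hΦ ((hY.prodMk hX) (hA.prod hB))]
      refine measure_congr ?_
      filter_upwards [hYinv] with p hp
      refine propext ?_
      change (Y (Φ p) ∈ A ∧ X (Φ p) ∈ B) ↔ _
      rw [hp]
      rfl
    have h2 : ∀ w, Q (Prod.mk w ⁻¹' {p : α × γ | Y p.1 ∈ A ∧ X (Φ p) ∈ B})
        = A.indicator 1 (Y w) * L w B := by
      intro w
      have hm : Measurable fun u => X (Φ (w, u)) := hXΦ.comp measurable_prodMk_left
      rw [hLw, Measure.map_apply hm hB]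
      by_cases hw : Y w ∈ A
      · simp [hw]; rfl
      · simp [hw]
    have hf : Measurable fun z : E × α => A.indicator (1 : E → ℝ≥0∞) z.1 * L z.2 B :=
      ((measurable_one.indicator hA).comp measurable_fst).mul
        ((L.measurable_coe hB).comp measurable_snd)
    rw [h1, Measure.prod_apply hS]
    simp only [h2]
    have h3 := lintegral_map (μ := M) hf hYw
    rw [← h3, ← hνM, Measure.lintegral_compProd hf, ← lintegral_indicator hA]
    refine lintegral_congr fun y => ?_
    by_cases hy : y ∈ A
    · simp only [hy, indicator_of_mem, Pi.one_apply, one_mul]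
      rw [Kernel.comp_apply' _ _ _ hB]
    · simp [hy]
  -- The set of good states need not be measurable, so it is replaced by a measurable subset of full
  -- measure before being transported through `ν`.
  · obtain ⟨G, hGsub, hGm, hG0⟩ : ∃ G ⊆ {w | Q.map (fun u => X (Φ (w, u))) ≪ Λ (n w) ∧
        Λ (n w) ≪ Q.map (fun u => X (Φ (w, u)))}, MeasurableSet G ∧ ∀ᵐ w ∂M, w ∈ G := by
      obtain ⟨t, ht, htm, ht0⟩ := exists_measurable_superset_of_null hΛ
      refine ⟨tᶜ, ?_, htm.compl, ?_⟩
      · intro w hw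
        by_contra h
        exact hw (ht h)
      · exact compl_mem_ae_iff.2 ht0
    have h1 : ∀ᵐ z ∂(M.map Y) ⊗ₘ ν, z.2 ∈ G ∧ n z.2 = g z.1 := by
      rw [hνM, ae_map_iff hYw.aemeasurable]
      · filter_upwards [hG0, hng] with w h h' using ⟨h, h'⟩
      · exact (measurable_snd hGm).inter
          (measurableSet_eq_fun (hn.comp measurable_snd) (hg.comp measurable_fst))
    have h2 := ae_of_ae_map hY.aemeasurable (Measure.ae_ae_of_ae_compProd h1)
    filter_upwards [h2, hng] with w hw hnw
    have hw' : ∀ᵐ w' ∂ν (Y w), L w' ≪ Λ (n w) ∧ Λ (n w) ≪ L w' := by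
      filter_upwards [hw] with w' h'
      have := hGsub h'.1
      rw [hLw, hnw, ← h'.2]
      exact this
    constructor
    · refine Measure.AbsolutelyContinuous.mk fun B hB hB0 => ?_
      rw [Kernel.comp_apply' _ _ _ hB, lintegral_eq_zero_iff (L.measurable_coe hB)]
      filter_upwards [hw'] with w' h' using h'.1 hB0
    -- If the mixture gives `B` mass zero, so does some component equivalent to `Λ (n w)`; one such
    -- component suffices.
    · refine Measure.AbsolutelyContinuous.mk fun B hB hB0 => ?_
      rw [Kernel.comp_apply' _ _ _ hB, lintegral_eq_zero_iff (L.measurable_coe hB)] at hB0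
      obtain ⟨w', h1, h2⟩ := (hw'.and hB0).exists
      exact h1.2 h2

/-- The replacement of the coordinates of `p.1` that lie in `D` by the coordinates of `p.2`. -/
def resample {ι α : Type*} (D : Set α) [DecidablePred (· ∈ D)] (p : (ι → α) × (ι → α))
    (k : ι) : α :=
  if p.1 k ∈ D then p.2 k else p.1 k

/-- The law `μ` conditioned to `D` (and `μ` itself if `D` is a null set). -/
noncomputable def condIn {α : Type*} [MeasurableSpace α] (D : Set α) (μ : Measure α) : Measure α :=
  open Classical in if μ D = 0 then μ else cond μ D

section Resample

variable {ι α : Type*} [MeasurableSpace α] {D : Set α} [DecidablePred (· ∈ D)]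

instance (D : Set α) (μ : Measure α) [IsProbabilityMeasure μ] :
    IsProbabilityMeasure (condIn D μ) := by
  unfold condIn
  split_ifs with h
  · infer_instance
  · exact cond_isProbabilityMeasure h

lemma measurable_resample (hD : MeasurableSet D) :
    Measurable (resample D : (ι → α) × (ι → α) → ι → α) := by
  rw [measurable_pi_iff]
  intro k
  refine Measurable.ite ?_ ?_ ?_
  · exact ((measurable_pi_apply k).comp measurable_fst) hD
  · exact (measurable_pi_apply k).comp measurable_snd
  · exact (measurable_pi_apply k).comp measurable_fst

/-- The one-coordinate case of the invariance. If `D` is null, the choice made in `condIn` is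
harmless, since both sides of `μ D * condIn D μ B = μ (B ∩ D)` vanish. -/
lemma prod_condIn_apply (hD : MeasurableSet D) (μ : Measure α) [IsProbabilityMeasure μ] {B : Set α}
    (hB : MeasurableSet B) :
    μ.prod (condIn D μ) {z | (if z.1 ∈ D then z.2 else z.1) ∈ B} = μ B := by
  have : {z : α × α | (if z.1 ∈ D then z.2 else z.1) ∈ B} = D ×ˢ B ∪ (B \ D) ×ˢ univ := by
    ext ⟨x, y⟩
    by_cases hx : x ∈ D <;> simp [hx]
  rw [this, measure_union _ ((hB.diff hD).prod .univ), Measure.prod_prod, Measure.prod_prod,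
    measure_univ, mul_one]
  · have : μ D * condIn D μ B = μ (B ∩ D) := by
      unfold condIn
      split_ifs with h
      · rw [h, zero_mul, measure_mono_null inter_subset_right h]
      · rw [cond_apply hD, ← mul_assoc, ENNReal.mul_inv_cancel h (measure_ne_top _ _), one_mul,
          inter_comm]
    rw [this, measure_inter_add_sdiff _ hD]
  · refine Set.disjoint_left.2 ?_
    rintro ⟨x, y⟩ h1 h2
    exact h2.1.2 h1.1

/-- An infinite product measure is invariant under the resampling of the coordinates in `D` from
their conditional laws. -/
lemma infinitePi_prod_map_resample (hD : MeasurableSet D) (μ : ι → Measure α)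
    [∀ i, IsProbabilityMeasure (μ i)] :
    ((Measure.infinitePi μ).prod (Measure.infinitePi fun i => condIn D (μ i))).map (resample D)
      = Measure.infinitePi μ := by
  refine Measure.eq_infinitePi _ fun s t ht => ?_
  have hbox := MeasurableSet.pi s.countable_toSet (t := t) fun i _ => ht i
  rw [Measure.map_apply (measurable_resample hD) hbox]
  set A : Set ((s → α) × (s → α)) :=
    {p | ∀ i : s, (if p.1 i ∈ D then p.2 i else p.1 i) ∈ t i} with hA
  have hpre : resample D ⁻¹' (Set.pi s t)
      = Prod.map (s.restrict (π := fun _ => α)) (s.restrict (π := fun _ => α)) ⁻¹' A := by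
    ext p
    simp only [hA, resample, Set.mem_pi, mem_preimage, Finset.mem_coe]
    exact ⟨fun h i => h i i.2, fun h i hi => h ⟨i, hi⟩⟩
  have hAm : MeasurableSet A := by
    rw [hA, ofPred_forall]
    refine MeasurableSet.iInter fun i => ?_
    refine Measurable.ite ?_ ?_ ?_ (ht i)
    · exact ((measurable_pi_apply i).comp measurable_fst) hD
    · exact (measurable_pi_apply i).comp measurable_snd
    · exact (measurable_pi_apply i).comp measurable_fst
  have hr := Finset.measurable_restrict (X := fun _ : ι => α) s
  rw [hpre, ← Measure.map_apply (hr.prodMap hr) hAm, ← Measure.map_prod_map _ _ hr hr,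
    Measure.infinitePi_map_restrict, Measure.infinitePi_map_restrict]
  have hmp := measurePreserving_arrowProdEquivProdArrow α α s (fun i => μ i)
    (fun i => condIn D (μ i))
  rw [← hmp.map_eq, Measure.map_apply hmp.measurable hAm]
  have : MeasurableEquiv.arrowProdEquivProdArrow α α s ⁻¹' A
      = Set.pi univ fun i : s => {z : α × α | (if z.1 ∈ D then z.2 else z.1) ∈ t i} := by
    ext z
    simp [hA, MeasurableEquiv.arrowProdEquivProdArrow, Equiv.arrowProdEquivProdArrow]
  rw [this, Measure.pi_pi, ← Finset.prod_coe_sort s fun i => μ i (t i)]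
  exact Finset.prod_congr rfl fun i _ => prod_condIn_apply hD (μ i) (ht i)

end Resample

lemma MeasureTheory.Measure.pi_fin_absolutelyContinuous {α : Type*} [MeasurableSpace α] {m : ℕ}
    {μ ν : Fin m → Measure α} [∀ i, SigmaFinite (μ i)] [∀ i, SigmaFinite (ν i)]
    (h : ∀ i, μ i ≪ ν i) : Measure.pi μ ≪ Measure.pi ν := by
  induction m with
  | zero => rw [Measure.pi_of_empty, Measure.pi_of_empty]
  | succ m ih =>
    have hμ := (measurePreserving_piFinSuccAbove μ 0).symm.map_eq
    have hν := (measurePreserving_piFinSuccAbove ν 0).symm.map_eq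
    rw [← hμ, ← hν]
    exact ((h 0).prod (ih fun i => h _)).map (MeasurableEquiv.measurable _)

-- Effect of resampling on the configuration

section Configuration

variable {S : Set ℤ} {D : Set ℝ} {w : ℤ → ℝ}

lemma configuration_apply {B : Set ℝ} (hB : MeasurableSet B) :
    configuration S w B = ∑' k : S, B.indicator 1 (w k) := by
  rw [configuration, Measure.sum_apply _ hB]
  exact tsum_congr fun k => Measure.dirac_apply' _ hB

lemma tsum_subtype_eq_sum_of_finset {T : Finset ℤ} (f : ℝ → ℝ≥0∞)
    (hT : ∀ k, k ∈ S → f (w k) ≠ 0 → k ∈ T) (hTS : ∀ k ∈ T, k ∈ S) :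
    ∑' k : S, f (w k) = ∑ k ∈ T, f (w k) := by
  rw [tsum_subtype S fun k => f (w k), tsum_eq_sum (s := T)]
  · exact Finset.sum_congr rfl fun k hk => indicator_of_mem (hTS k hk) _
  · intro k hk
    by_cases hS : k ∈ S
    · rw [indicator_of_mem hS]
      by_contra h
      exact hk (hT k hS h)
    · rw [indicator_of_notMem hS]

lemma configuration_restrict_eq_sum (hD : MeasurableSet D) {T : Finset ℤ}
    (hT : ∀ k, k ∈ T ↔ k ∈ S ∧ w k ∈ D) :
    (configuration S w).restrict D = ∑ k ∈ T, Measure.dirac (w k) := by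
  refine Measure.ext fun B hB => ?_
  rw [Measure.restrict_apply hB, configuration_apply (hB.inter hD),
    tsum_subtype_eq_sum_of_finset (T := T) _ ?_ fun k hk => ((hT k).1 hk).1,
    Measure.finsetSum_apply]
  · refine Finset.sum_congr rfl fun k hk => ?_
    rw [Measure.dirac_apply' _ hB]
    have := ((hT k).1 hk).2
    by_cases hwB : w k ∈ B <;> simp [hwB, this]
  · intro k hS h
    rw [hT]
    refine ⟨hS, ?_⟩
    by_contra hk
    exact h (indicator_of_notMem (fun h' => hk h'.2) _)

lemma configuration_apply_eq_card (hD : MeasurableSet D) {T : Finset ℤ}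
    (hT : ∀ k, k ∈ T ↔ k ∈ S ∧ w k ∈ D) : configuration S w D = T.card := by
  rw [configuration_apply hD,
    tsum_subtype_eq_sum_of_finset (T := T) _ ?_ fun k hk => ((hT k).1 hk).1]
  · rw [Finset.sum_congr rfl fun k hk => indicator_of_mem ((hT k).1 hk).2 _]
    simp
  · intro k hS h
    rw [hT]
    refine ⟨hS, ?_⟩
    by_contra hk
    exact h (indicator_of_notMem hk _)

variable {u : ℤ → ℝ} [DecidablePred (· ∈ D)]

lemma resample_mem_iff (hu : ∀ k, w k ∈ D → u k ∈ D) (k : ℤ) :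
    resample D (w, u) k ∈ D ↔ w k ∈ D := by
  by_cases h : w k ∈ D <;> simp [resample, h, hu]

lemma configuration_resample_restrict_compl (hD : MeasurableSet D)
    (hu : ∀ k, w k ∈ D → u k ∈ D) :
    (configuration S (resample D (w, u))).restrict Dᶜ = (configuration S w).restrict Dᶜ := by
  refine Measure.ext fun B hB => ?_
  rw [Measure.restrict_apply hB, Measure.restrict_apply hB, configuration_apply (hB.inter hD.compl),
    configuration_apply (hB.inter hD.compl)]
  refine tsum_congr fun k => ?_
  by_cases h : w k ∈ D
  · simp [indicator, resample, h, hu]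
  · have : resample D (w, u) k = w k := if_neg h
    rw [this]

lemma configuration_resample_apply (hD : MeasurableSet D) (hu : ∀ k, w k ∈ D → u k ∈ D) :
    configuration S (resample D (w, u)) D = configuration S w D := by
  rw [configuration_apply hD, configuration_apply hD]
  refine tsum_congr fun k => ?_
  have := resample_mem_iff hu k
  by_cases h : w k ∈ D <;> simp [this, h]

lemma configuration_resample_restrict (hD : MeasurableSet D) (hu : ∀ k, w k ∈ D → u k ∈ D)
    {T : Finset ℤ} (hT : ∀ k, k ∈ T ↔ k ∈ S ∧ w k ∈ D) :
    (configuration S (resample D (w, u))).restrict D = ∑ k ∈ T, Measure.dirac (u k) := by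
  rw [configuration_restrict_eq_sum (T := T) hD fun k => by rw [hT, resample_mem_iff hu]]
  refine Finset.sum_congr rfl fun k hk => ?_
  simp [resample, ((hT k).1 hk).2]

end Configuration

lemma condIn_gaussianReal_absolutelyContinuous {D : Set ℝ} {m : ℝ} {v : ℝ≥0} (hv : v ≠ 0)
    (h : gaussianReal m v D ≠ 0) :
    condIn D (gaussianReal m v) ≪ volume.restrict D ∧
      volume.restrict D ≪ condIn D (gaussianReal m v) := by
  rw [condIn, if_neg h, ProbabilityTheory.cond]
  constructor
  · exact Measure.smul_absolutelyContinuous.trans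
      ((gaussianReal_absolutelyContinuous m hv).restrict D)
  · exact ((gaussianReal_absolutelyContinuous' m hv).restrict D).trans
      (Measure.absolutelyContinuous_smul (by simp))

lemma measurable_pointsMeasure {m : ℕ} : Measurable (pointsMeasure (m := m)) := by
  unfold pointsMeasure
  exact Finset.measurable_sum _ fun i _ => Measure.measurable_dirac.comp (measurable_pi_apply i)

/-- The law of the configuration of `m` independent uniform points of `D`, up to equivalence. -/
noncomputable def lebesgueConfig (D : Set ℝ) (m : ℕ) : Measure (Measure ℝ) :=
  (volume.restrict (univ.pi fun _ : Fin m => D)).map pointsMeasure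

/-- The law from which the coordinates in `D` are resampled. -/
noncomputable def resampleLaw (D : Set ℝ) (v : ℤ → ℝ≥0) : Measure (ℤ → ℝ) :=
  Measure.infinitePi fun k => condIn D (gaussianReal k (v k))

instance (D : Set ℝ) (v : ℤ → ℝ≥0) : IsProbabilityMeasure (resampleLaw D v) := by
  unfold resampleLaw; infer_instance

/-- The coordinates with labels in `T` are independent, each with a law equivalent to Lebesgue
measure on `D`; finite products and images preserve equivalence. Enumerating `T` by `Fin T.card`
erases the labels. -/
lemma resampleLaw_map_sum_dirac {D : Set ℝ} {v : ℤ → ℝ≥0} {T : Finset ℤ}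
    (hv : ∀ k ∈ T, v k ≠ 0) (hT : ∀ k ∈ T, gaussianReal k (v k) D ≠ 0) :
    (resampleLaw D v).map (fun u => ∑ k ∈ T, Measure.dirac (u k)) ≪ lebesgueConfig D T.card ∧
      lebesgueConfig D T.card ≪ (resampleLaw D v).map fun u => ∑ k ∈ T, Measure.dirac (u k) := by
  set e : Fin T.card → ℤ := fun i => (T.equivFin.symm i : ℤ) with he
  have hinj : Function.Injective e := fun i j h => T.equivFin.symm.injective (Subtype.ext h)
  have heT : ∀ i, e i ∈ T := fun i => (T.equivFin.symm i).2
  have hsum : (fun u : ℤ → ℝ => ∑ k ∈ T, Measure.dirac (u k))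
      = pointsMeasure ∘ fun u i => u (e i) := by
    funext u
    simp only [pointsMeasure, Function.comp_apply, he]
    rw [← Finset.sum_coe_sort T fun k => Measure.dirac (u k)]
    exact (Equiv.sum_comp T.equivFin.symm fun k : T => Measure.dirac (u k)).symm
  have hm : Measurable fun (u : ℤ → ℝ) i => u (e i) :=
    measurable_pi_iff.2 fun i => measurable_pi_apply _
  rw [hsum, ← Measure.map_map measurable_pointsMeasure hm, resampleLaw,
    Measure.map_infinitePi_infinitePi_of_inj hinj, Measure.infinitePi_eq_pi, lebesgueConfig,
    volume_pi, Measure.restrict_pi_pi]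
  have h := fun i => condIn_gaussianReal_absolutelyContinuous (hv _ (heT i)) (hT _ (heT i))
  exact ⟨(Measure.pi_fin_absolutelyContinuous fun i => (h i).1).map measurable_pointsMeasure,
    (Measure.pi_fin_absolutelyContinuous fun i => (h i).2).map measurable_pointsMeasure⟩

lemma ae_latticeLaw_measure_ne_zero (D : Set ℝ) (v : ℤ → ℝ≥0) :
    ∀ᵐ w ∂latticeLaw v, ∀ k : ℤ, w k ∈ D → gaussianReal k (v k) D ≠ 0 := by
  rw [ae_all_iff]
  intro k
  by_cases h : gaussianReal k (v k) D = 0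
  · have hk := measurePreserving_eval_infinitePi (fun k : ℤ => gaussianReal k (v k)) k
    have : ∀ᵐ w ∂latticeLaw v, w k ∈ Dᶜ := by
      refine hk.quasiMeasurePreserving.ae (p := (· ∈ Dᶜ)) ?_
      exact compl_mem_ae_iff.2 h
    filter_upwards [this] with w hw h'
    exact absurd h' hw
  · exact Filter.Eventually.of_forall fun w _ => h

lemma ae_resampleLaw_mem {D : Set ℝ} (hD : MeasurableSet D) (v : ℤ → ℝ≥0) :
    ∀ᵐ u ∂resampleLaw D v, ∀ k : ℤ, gaussianReal k (v k) D ≠ 0 → u k ∈ D := by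
  rw [ae_all_iff]
  intro k
  by_cases h : gaussianReal k (v k) D = 0
  · exact Filter.Eventually.of_forall fun w h' => absurd h h'
  · have hk := measurePreserving_eval_infinitePi (fun k : ℤ => condIn D (gaussianReal k (v k))) k
    have : ∀ᵐ u ∂resampleLaw D v, u k ∈ D := by
      refine hk.quasiMeasurePreserving.ae (p := (· ∈ D)) ?_
      rw [condIn, if_neg h, ProbabilityTheory.cond]
      exact (Measure.smul_absolutelyContinuous.ae_le) (ae_restrict_mem hD)
    filter_upwards [this] with u hu _ using hu

/-- A coordinate that can be in `D` has positive probability of being there, so its replacement is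
drawn from a law living on `D`. Hence resampling moves no point across the boundary. -/
lemma ae_resample_mem {D : Set ℝ} (hD : MeasurableSet D) (v : ℤ → ℝ≥0) :
    ∀ᵐ p ∂(latticeLaw v).prod (resampleLaw D v), ∀ k, p.1 k ∈ D → p.2 k ∈ D := by
  filter_upwards [Measure.quasiMeasurePreserving_fst.ae (ae_latticeLaw_measure_ne_zero D v),
    Measure.quasiMeasurePreserving_snd.ae (ae_resampleLaw_mem hD v)] with p h1 h2 k hk
  exact h2 k (h1 k hk)

lemma ae_latticeLaw_eq_of_var_eq_zero {v : ℤ → ℝ≥0} {k : ℤ} (hv : v k = 0) :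
    ∀ᵐ w ∂latticeLaw v, w k = (k : ℝ) := by
  have hk := measurePreserving_eval_infinitePi (fun k : ℤ => gaussianReal k (v k)) k
  refine hk.quasiMeasurePreserving.ae (p := (· = (k : ℝ))) ?_
  rw [hv, gaussianReal_zero_var, ae_dirac_eq]
  rfl

/-- The law of the configuration in `D`, after the positions of the points in `D` are resampled,
is equivalent to that of `m` uniform points, where `m` is the number of points in `D`. -/
lemma ae_resample_equivalent {S : Set ℤ} {D : Set ℝ} [DecidablePred (· ∈ D)]
    (hD : MeasurableSet D) {v : ℤ → ℝ≥0} (hv : ∀ k ∈ S, v k ≠ 0)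
    (hfin : ∀ᵐ w ∂latticeLaw v, {k | k ∈ S ∧ w k ∈ D}.Finite) :
    ∀ᵐ w ∂latticeLaw v, ∃ m : ℕ, configuration S w D = m ∧
      (resampleLaw D v).map (fun u => (configuration S (resample D (w, u))).restrict D)
        ≪ lebesgueConfig D m ∧
      lebesgueConfig D m ≪
        (resampleLaw D v).map fun u => (configuration S (resample D (w, u))).restrict D := by
  filter_upwards [hfin, ae_latticeLaw_measure_ne_zero D v] with w hw hw'
  have hT : ∀ k, k ∈ hw.toFinset ↔ k ∈ S ∧ w k ∈ D := fun k => by simp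
  refine ⟨hw.toFinset.card, configuration_apply_eq_card hD hT, ?_⟩
  have h := resampleLaw_map_sum_dirac (T := hw.toFinset) (D := D)
    (fun k hk => hv k ((hT k).1 hk).1) (fun k hk => hw' k ((hT k).1 hk).2)
  have : (resampleLaw D v).map (fun u => (configuration S (resample D (w, u))).restrict D)
      = (resampleLaw D v).map fun u => ∑ k ∈ hw.toFinset, Measure.dirac (u k) := by
    refine Measure.map_congr ?_
    filter_upwards [ae_resampleLaw_mem hD v] with u hu
    exact configuration_resample_restrict hD (fun k hk => hu k (hw' k hk)) hT
  rw [this]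
  exact h

-- Gaussian moments, local finiteness and simplicity

section Moments

lemma gaussianReal_eq_map_standard (m : ℝ) (v : ℝ≥0) :
    gaussianReal m v = (gaussianReal 0 1).map fun x => m + √v * x := by
  have h1 := gaussianReal_map_const_mul (μ := 0) (v := 1) √v
  have h2 := gaussianReal_map_const_add (μ := √(v : ℝ) * 0)
    (v := .mk (√(v : ℝ) ^ 2) (sq_nonneg _) * 1) m
  rw [← h1, Measure.map_map (by fun_prop) (by fun_prop)] at h2
  change _ = Measure.map ((fun x => m + x) ∘ fun x => √v * x) _
  rw [h2]
  congr 1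
  · simp
  · ext; simp

lemma integrable_gaussianReal_sub_pow (m : ℝ) (v : ℝ≥0) (n : ℕ) :
    Integrable (fun x => (x - m) ^ n) (gaussianReal m v) := by
  have h : MemLp (fun x => x - m) n (gaussianReal m v) :=
    (memLp_id_gaussianReal' (n : ℝ≥0∞) (by simp)).sub (memLp_const m)
  refine (integrable_norm_iff (by fun_prop)).1 ?_
  simpa only [norm_pow] using h.integrable_norm_pow' (p := n)

lemma integral_gaussianReal_sub_pow (m : ℝ) (v : ℝ≥0) (n : ℕ) :
    ∫ x, (x - m) ^ (2 * n) ∂gaussianReal m v = v ^ n * ∫ x, x ^ (2 * n) ∂gaussianReal 0 1 := by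
  rw [gaussianReal_eq_map_standard, integral_map (by fun_prop) (by fun_prop), ← integral_const_mul]
  congr 1
  funext x
  rw [add_sub_cancel_left, mul_pow, pow_mul √(v : ℝ), Real.sq_sqrt (NNReal.coe_nonneg v)]

lemma integral_gaussianReal_sub_sq (m : ℝ) (v : ℝ≥0) :
    ∫ x, (x - m) ^ 2 ∂gaussianReal m v = v := by
  have h := variance_eq_integral (μ := gaussianReal m v) (X := id) aemeasurable_id
  rw [variance_id_gaussianReal] at h
  simpa using h.symm

end Moments

section LocalFiniteness

variable {v : ℤ → ℝ≥0}

lemma measurePreserving_eval_latticeLaw (v : ℤ → ℝ≥0) (k : ℤ) :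
    MeasurePreserving (Function.eval k) (latticeLaw v) (gaussianReal k (v k)) :=
  measurePreserving_eval_infinitePi (fun k : ℤ => gaussianReal k (v k)) k

/-- Markov's inequality for the sixth power: the moment scales as s³ ≤ |k|³ against (|k| / 2)⁶,
which gives 64 |k|⁻³, summable for Borel–Cantelli. -/
lemma gaussianReal_real_far_le {k : ℤ} (hk : k ≠ 0) {s : ℝ≥0} (hs : (s : ℝ) ≤ |(k : ℝ)|) :
    (gaussianReal k s).real {x | |(k : ℝ)| / 2 ≤ |x - k|}
      ≤ 64 * (∫ x, x ^ 6 ∂gaussianReal 0 1) * |(k : ℝ)| ^ (-3 : ℝ) := by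
  have hk' : 0 < |(k : ℝ)| := by positivity
  have h := mul_meas_ge_le_integral_of_nonneg (μ := gaussianReal k s) (f := fun x => (x - k) ^ 6)
    (Filter.Eventually.of_forall fun x => by positivity) (integrable_gaussianReal_sub_pow _ _ 6)
    ((|(k : ℝ)| / 2) ^ 6)
  have hset : {x : ℝ | |(k : ℝ)| / 2 ≤ |x - k|} ⊆ {x | (|(k : ℝ)| / 2) ^ 6 ≤ (x - k) ^ 6} := by
    intro x hx
    have := pow_le_pow_left₀ (by positivity) (mem_ofPred_eq ▸ hx) 6
    rwa [Even.pow_abs (by decide : Even 6)] at this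
  have hC : 0 ≤ ∫ x, x ^ 6 ∂gaussianReal 0 1 := integral_nonneg fun x => by positivity
  have hm := integral_gaussianReal_sub_pow k s 3
  norm_num only at hm
  rw [hm] at h
  have h1 : (s : ℝ) ^ 3 ≤ |(k : ℝ)| ^ 3 := pow_le_pow_left₀ s.2 hs 3
  have h2 := measureReal_mono (μ := gaussianReal k s) hset
  have h3 : (|(k : ℝ)| / 2) ^ 6 * (gaussianReal k s).real {x | |(k : ℝ)| / 2 ≤ |x - k|}
      ≤ |(k : ℝ)| ^ 3 * ∫ x, x ^ 6 ∂gaussianReal 0 1 := by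
    calc _ ≤ _ := mul_le_mul_of_nonneg_left h2 (by positivity)
      _ ≤ _ := h
      _ ≤ _ := mul_le_mul_of_nonneg_right h1 hC
  have h4 : |(k : ℝ)| ^ (-3 : ℝ) = (|(k : ℝ)| ^ 3)⁻¹ := by
    rw [Real.rpow_neg hk'.le]
    congr 1
    exact_mod_cast Real.rpow_natCast |(k : ℝ)| 3
  rw [h4]
  rw [← le_div_iff₀' (by positivity)] at h3
  refine h3.trans (le_of_eq ?_)
  field_simp
  norm_num

/-- Almost surely, all but finitely many points are displaced by less than half the distance of
their label to the origin. -/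
lemma ae_finite_far (hv : ∀ k, k ≠ 0 → (v k : ℝ) ≤ |(k : ℝ)|) :
    ∀ᵐ w ∂latticeLaw v, {k : ℤ | |(k : ℝ)| / 2 ≤ |w k - (k : ℝ)|}.Finite := by
  refine ae_finite_setOfPred_mem
    (s := fun k : ℤ => {w : ℤ → ℝ | |(k : ℝ)| / 2 ≤ |w k - (k : ℝ)|}) ?_
  have hsum : Summable fun k : ℤ => (latticeLaw v).real {w | |(k : ℝ)| / 2 ≤ |w k - (k : ℝ)|} := by
    rw [← (finite_singleton (0 : ℤ)).summable_compl_iff]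
    refine Summable.of_nonneg_of_le (fun _ => measureReal_nonneg) (fun k => ?_)
      (((Real.summable_abs_int_rpow (b := 3) (by norm_num)).mul_left
        (64 * (∫ x, x ^ 6 ∂gaussianReal 0 1))).subtype _)
    have hk : (k : ℤ) ≠ 0 := k.2
    have := gaussianReal_real_far_le hk (hv k hk)
    have hmp := measurePreserving_eval_latticeLaw v k
    rw [← hmp.map_eq, map_measureReal_apply hmp.measurable (by measurability)] at this
    exact this
  have := hsum.tsum_ofReal_ne_top
  have h : ∀ k : ℤ, ENNReal.ofReal ((latticeLaw v).real {w | |(k : ℝ)| / 2 ≤ |w k - (k : ℝ)|})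
      = latticeLaw v {w | |(k : ℝ)| / 2 ≤ |w k - (k : ℝ)|} := fun k => ofReal_measureReal
  simpa only [h] using this

lemma ae_finite_mem_of_isBounded (hv : ∀ k, k ≠ 0 → (v k : ℝ) ≤ |(k : ℝ)|) :
    ∀ᵐ w ∂latticeLaw v, ∀ B : Set ℝ, Bornology.IsBounded B → {k : ℤ | w k ∈ B}.Finite := by
  filter_upwards [ae_finite_far hv] with w hw B hB
  obtain ⟨R, hR⟩ := hB.exists_norm_le
  refine (hw.union (finite_Icc (-⌈2 * R⌉) ⌈2 * R⌉)).subset fun k hk => ?_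
  by_cases h : |(k : ℝ)| / 2 ≤ |w k - (k : ℝ)|
  · exact Or.inl h
  · right
    have h1 := hR _ hk
    rw [Real.norm_eq_abs] at h1
    -- A point displaced by less than |k| / 2 stays at distance at least |k| / 2 from the origin.
    have h2 : |(k : ℝ)| ≤ 2 * R := by
      have := abs_sub_abs_le_abs_sub (k : ℝ) (w k)
      rw [abs_sub_comm] at this
      linarith
    have h3 : |(k : ℝ)| ≤ ⌈2 * R⌉ := h2.trans (Int.le_ceil _)
    rw [mem_Icc, ← abs_le]
    exact_mod_cast h3

/-- Two independent points almost surely differ as soon as one of them has no atoms, so a single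
deterministic point is allowed. -/
lemma ae_injective {S : Set ℤ} (hS : ∀ j ∈ S, ∀ k ∈ S, j ≠ k → v j ≠ 0 ∨ v k ≠ 0) :
    ∀ᵐ w ∂latticeLaw v, ∀ j ∈ S, ∀ k ∈ S, w j = w k → j = k := by
  have key : ∀ j k : ℤ, j ≠ k → v j ≠ 0 → ∀ᵐ w ∂latticeLaw v, w j ≠ w k := by
    intro j k hjk hj
    have h := Measure.infinitePi_map_eval_prod (P := fun k : ℤ => gaussianReal k (v k)) hjk
    have hm : Measurable fun w : ℤ → ℝ => (w j, w k) := by fun_prop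
    refine ae_of_ae_map (f := fun w : ℤ → ℝ => (w j, w k)) (p := fun z => z.1 ≠ z.2)
      hm.aemeasurable ?_
    rw [latticeLaw, h]
    have hset : MeasurableSet {z : ℝ × ℝ | z.1 = z.2} :=
      measurableSet_eq_fun measurable_fst measurable_snd
    rw [ae_iff]
    simp only [ne_eq, not_not]
    rw [Measure.prod_apply_symm hset, lintegral_eq_zero_iff (measurable_measure_prodMk_right hset)]
    refine Filter.Eventually.of_forall fun y => ?_
    have : (fun x : ℝ => (x, y)) ⁻¹' {z : ℝ × ℝ | z.1 = z.2} = {y} := by ext; simp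
    have hna := nullSingletonClass_gaussianReal (μ := (j : ℝ)) hj
    change gaussianReal j (v j) ((fun x : ℝ => (x, y)) ⁻¹' {z : ℝ × ℝ | z.1 = z.2}) = 0
    rw [this]
    exact measure_singleton y
  simp only [ae_all_iff]
  intro j hj k hk
  by_cases hjk : j = k
  · exact Filter.Eventually.of_forall fun w _ => hjk
  · rcases hS j hj k hk hjk with h | h
    · filter_upwards [key j k hjk h] with w hw hw' using absurd hw' hw
    · filter_upwards [key k j (Ne.symm hjk) h] with w hw hw' using absurd hw'.symm hw

end LocalFiniteness

-- Number rigidity from linear statistics of small variance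

/-- A cutoff function on the logarithmic scale, supported by `[-N, N]`. -/
noncomputable def logCutoff (N : ℕ) (x : ℝ) : ℝ :=
  max 0 (1 - Real.log (1 + |x|) / Real.log (1 + N))

lemma logCutoff_nonneg (N : ℕ) (x : ℝ) : 0 ≤ logCutoff N x := le_max_left _ _

lemma log_one_add_nat_nonneg (N : ℕ) : 0 ≤ Real.log (1 + N) :=
  Real.log_nonneg (by simp)

lemma logCutoff_le_one (N : ℕ) (x : ℝ) : logCutoff N x ≤ 1 := by
  refine max_le zero_le_one ?_
  have : 0 ≤ Real.log (1 + |x|) / Real.log (1 + N) :=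
    div_nonneg (Real.log_nonneg (by simp)) (log_one_add_nat_nonneg N)
  linarith

lemma measurable_logCutoff (N : ℕ) : Measurable (logCutoff N) := by
  unfold logCutoff
  fun_prop

lemma logCutoff_eq_zero {N : ℕ} (hN : 0 < N) {x : ℝ} (hx : N ≤ |x|) : logCutoff N x = 0 := by
  refine max_eq_left ?_
  have hN' : (0 : ℝ) < N := by exact_mod_cast hN
  have h : 1 ≤ Real.log (1 + |x|) / Real.log (1 + N) := by
    rw [one_le_div (Real.log_pos (by linarith))]
    exact Real.log_le_log (by linarith) (by linarith)
  linarith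

lemma abs_logCutoff_sub_le (N : ℕ) (x y : ℝ) : |logCutoff N x - logCutoff N y|
    ≤ |Real.log (1 + |x|) - Real.log (1 + |y|)| / Real.log (1 + N) := by
  unfold logCutoff
  rw [max_comm, max_comm 0]
  refine (abs_max_sub_max_le_abs _ _ _).trans ?_
  conv_rhs => rw [← abs_of_nonneg (log_one_add_nat_nonneg N)]
  rw [← abs_div, abs_sub_comm]
  refine le_of_eq ?_
  congr 1
  ring

lemma tendsto_log_one_add_nat :
    Filter.Tendsto (fun N : ℕ => Real.log (1 + N)) Filter.atTop Filter.atTop :=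
  Real.tendsto_log_atTop.comp
    (Filter.tendsto_atTop_add_const_left _ _ tendsto_natCast_atTop_atTop)

lemma tendsto_logCutoff (x : ℝ) :
    Filter.Tendsto (fun N => logCutoff N x) Filter.atTop (𝓝 1) := by
  have h := (tendsto_const_nhds (x := Real.log (1 + |x|))).div_atTop tendsto_log_one_add_nat
  have h2 := (tendsto_const_nhds (x := (0 : ℝ))).max ((tendsto_const_nhds (x := (1 : ℝ))).sub h)
  simpa [logCutoff] using h2

lemma abs_log_sub_log_le {a b c : ℝ} (hc : 0 < c) (ha : c ≤ a) (hb : c ≤ b) :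
    |Real.log a - Real.log b| ≤ |a - b| / c := by
  have key : ∀ a b : ℝ, c ≤ a → c ≤ b → Real.log a - Real.log b ≤ |a - b| / c := by
    intro a b ha hb
    have ha0 := hc.trans_le ha
    have hb0 := hc.trans_le hb
    rw [← Real.log_div ha0.ne' hb0.ne']
    calc Real.log (a / b) ≤ a / b - 1 := Real.log_le_sub_one_of_pos (div_pos ha0 hb0)
      _ = (a - b) / b := by field_simp
      _ ≤ |a - b| / b := by gcongr; exact le_abs_self _
      _ ≤ |a - b| / c := by gcongr
  rw [abs_le]
  refine ⟨?_, key a b ha hb⟩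
  have := key b a hb ha
  rw [abs_sub_comm] at this
  linarith

/-- For x within |k| / 2 of k, the logarithm is Lipschitz with constant 2 / |k|, which gives the
first term. Otherwise the constant is only 1, and the second term pays for it. -/
lemma sq_log_one_add_abs_sub_le {x k : ℝ} (hk : k ≠ 0) :
    (Real.log (1 + |x|) - Real.log (1 + |k|)) ^ 2
      ≤ 4 / k ^ 2 * (x - k) ^ 2 + 16 / k ^ 4 * (x - k) ^ 6 := by
  have hk' : 0 < |k| := abs_pos.2 hk
  have hd : |(1 + |x|) - (1 + |k|)| ≤ |x - k| := by
    have := abs_abs_sub_abs_le_abs_sub x k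
    simpa using this
  rw [← sq_abs]
  by_cases h : |x - k| ≤ |k| / 2
  · have hx : |k| / 2 ≤ |x| := by
      have := abs_sub_abs_le_abs_sub k x
      rw [abs_sub_comm] at this
      linarith
    have h1 := abs_log_sub_log_le (a := 1 + |x|) (b := 1 + |k|) (half_pos hk') (by linarith)
      (by linarith)
    have h2 : |Real.log (1 + |x|) - Real.log (1 + |k|)| ≤ |x - k| / (|k| / 2) :=
      h1.trans (by gcongr)
    calc _ ≤ (|x - k| / (|k| / 2)) ^ 2 := pow_le_pow_left₀ (abs_nonneg _) h2 2
      _ = 4 / k ^ 2 * (x - k) ^ 2 := by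
        rw [div_pow, div_pow, sq_abs, sq_abs]
        field_simp
        norm_num
      _ ≤ _ := le_add_of_nonneg_right (by positivity)
  · push Not at h
    have h1 := abs_log_sub_log_le (a := 1 + |x|) (b := 1 + |k|) one_pos
      (by linarith [abs_nonneg x]) (by linarith)
    rw [div_one] at h1
    calc _ ≤ |x - k| ^ 2 := pow_le_pow_left₀ (abs_nonneg _) (h1.trans hd) 2
      -- Here |k| / 2 < |x - k|, so four powers of |k| / 2 can be traded for |x - k|.
      _ = 16 / k ^ 4 * ((|k| / 2) ^ 4 * |x - k| ^ 2) := by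
        rw [div_pow, Even.pow_abs (by decide : Even 4)]
        field_simp
        norm_num
      _ ≤ 16 / k ^ 4 * (|x - k| ^ 4 * |x - k| ^ 2) := by gcongr
      _ = 16 / k ^ 4 * (x - k) ^ 6 := by
        rw [← pow_add, Even.pow_abs (by decide : Even (4 + 2))]
      _ ≤ _ := le_add_of_nonneg_left (by positivity)

lemma memLp_logCutoff (N : ℕ) (μ : Measure ℝ) [IsFiniteMeasure μ] :
    MemLp (logCutoff N) 2 μ :=
  MemLp.of_bound (measurable_logCutoff N).aestronglyMeasurable 1
    (Filter.Eventually.of_forall fun x => by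
      rw [Real.norm_eq_abs, abs_of_nonneg (logCutoff_nonneg N x)]
      exact logCutoff_le_one N x)

lemma variance_le_of_sq_sub_le {μ : Measure ℝ} [IsProbabilityMeasure μ] {f h : ℝ → ℝ}
    (hf : Measurable f) (c : ℝ) (hh : Integrable h μ) (hle : ∀ x, (f x - c) ^ 2 ≤ h x) :
    Var[f; μ] ≤ ∫ x, h x ∂μ := by
  calc Var[f; μ] = Var[fun x => f x - c; μ] :=
        (variance_sub_const hf.aestronglyMeasurable c).symm
    _ ≤ ∫ x, (f x - c) ^ 2 ∂μ :=
        variance_le_expectation_sq (hf.sub_const c).aestronglyMeasurable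
    _ ≤ ∫ x, h x ∂μ := by
        refine integral_mono_of_nonneg (Filter.Eventually.of_forall fun x => sq_nonneg _) hh
          (Filter.Eventually.of_forall hle)

/-- A bound for the variances of the terms of the linear statistic of `logCutoff`. -/
noncomputable def logVarianceBound (v₀ : ℝ≥0) (k : ℤ) : ℝ :=
  if k = 0 then v₀ else (4 + 16 * ∫ x, x ^ 6 ∂gaussianReal 0 1) * |(k : ℝ)|⁻¹

/-- With variance at most |k|, the second moment over k² and the sixth moment over k⁴ are both O(1 /
|k|). The label 0, whose variance is arbitrary, uses the Lipschitz bound of log(1 + |x|) instead. -/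
lemma variance_logCutoff_le (N : ℕ) {v : ℤ → ℝ≥0}
    (hv : ∀ k, k ≠ 0 → (v k : ℝ) ≤ |(k : ℝ)|) (k : ℤ) :
    Var[logCutoff N; gaussianReal k (v k)] ≤ logVarianceBound (v 0) k / Real.log (1 + N) ^ 2 := by
  have hsq : ∀ x, (logCutoff N x - logCutoff N k) ^ 2
      ≤ (Real.log (1 + |x|) - Real.log (1 + |(k : ℝ)|)) ^ 2 / Real.log (1 + N) ^ 2 := by
    intro x
    rw [← sq_abs, ← sq_abs (Real.log (1 + |x|) - _), ← div_pow]
    exact pow_le_pow_left₀ (abs_nonneg _) (abs_logCutoff_sub_le N x k) 2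
  have hi2 := integrable_gaussianReal_sub_pow k (v k) 2
  have hi6 := integrable_gaussianReal_sub_pow k (v k) 6
  by_cases hk : k = 0
  · subst hk
    have := variance_le_of_sq_sub_le (h := fun x => (x - ((0 : ℤ) : ℝ)) ^ 2 / Real.log (1 + N) ^ 2)
      (measurable_logCutoff N) (logCutoff N ((0 : ℤ) : ℝ))
      (hi2.div_const _) fun x => (hsq x).trans (by
        gcongr ?_ / _
        rw [← sq_abs, ← sq_abs (x - _)]
        have h1 := abs_log_sub_log_le (a := 1 + |x|) (b := 1 + |((0 : ℤ) : ℝ)|) one_pos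
          (by linarith [abs_nonneg x]) (by simp)
        refine pow_le_pow_left₀ (abs_nonneg _) (h1.trans ?_) 2
        simp)
    rw [integral_div, integral_gaussianReal_sub_sq] at this
    simpa [logVarianceBound] using this
  · have hk0 : (k : ℝ) ≠ 0 := by exact_mod_cast hk
    have hk' : 0 < |(k : ℝ)| := abs_pos.2 hk0
    have := variance_le_of_sq_sub_le
      (h := fun x => (4 / (k : ℝ) ^ 2 * (x - k) ^ 2 + 16 / (k : ℝ) ^ 4 * (x - k) ^ 6)
        / Real.log (1 + N) ^ 2)
      (measurable_logCutoff N) (logCutoff N k)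
      (((hi2.const_mul _).add (hi6.const_mul _)).div_const _) fun x => (hsq x).trans (by
        gcongr ?_ / _
        exact sq_log_one_add_abs_sub_le hk0)
    refine this.trans ?_
    rw [integral_div, integral_add (hi2.const_mul _) (hi6.const_mul _), integral_const_mul,
      integral_const_mul, integral_gaussianReal_sub_sq]
    have hm := integral_gaussianReal_sub_pow k (v k) 3
    norm_num only at hm
    rw [hm, logVarianceBound, if_neg hk]
    have hC : 0 ≤ ∫ x, x ^ 6 ∂gaussianReal 0 1 := integral_nonneg fun x => by positivity
    have hvk := hv k hk
    have hv3 : (v k : ℝ) ^ 3 ≤ |(k : ℝ)| ^ 3 := pow_le_pow_left₀ (v k).2 hvk 3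
    gcongr ?_ / _
    calc _ ≤ 4 / (k : ℝ) ^ 2 * |(k : ℝ)| + 16 / (k : ℝ) ^ 4 * (|(k : ℝ)| ^ 3 *
          ∫ x, x ^ 6 ∂gaussianReal 0 1) := by gcongr
      _ = _ := by
        rw [← Even.pow_abs (by decide : Even 2), ← Even.pow_abs (by decide : Even 4) (k : ℝ)]
        field_simp

lemma sum_Icc_abs_inv (M : ℕ) :
    ∑ k ∈ Finset.Icc (-(M : ℤ)) M, |(k : ℝ)|⁻¹ = 2 * (harmonic M : ℝ) := by
  induction M with
  | zero => simp
  | succ M ih =>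
    have h : Finset.Icc (-((M + 1 : ℕ) : ℤ)) (M + 1 : ℕ)
        = insert (-((M + 1 : ℕ) : ℤ)) (insert ((M + 1 : ℕ) : ℤ) (Finset.Icc (-(M : ℤ)) M)) := by
      ext k
      simp only [Finset.mem_Icc, Finset.mem_insert]
      omega
    rw [h, Finset.sum_insert, Finset.sum_insert, ih, harmonic_succ]
    · push_cast
      rw [abs_neg, abs_of_nonneg (by positivity : (0 : ℝ) ≤ M + 1)]
      ring
    · simp only [Finset.mem_Icc]; omega
    · simp only [Finset.mem_Icc, Finset.mem_insert]; omega

/-- The harmonic sum up to 2N is of order log N, against the square of log N: this gain is the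
reason for the logarithmic cutoff. -/
lemma tendsto_sum_logVarianceBound (v₀ : ℝ≥0) :
    Filter.Tendsto (fun N : ℕ => (∑ k ∈ Finset.Icc (-((2 * N : ℕ) : ℤ)) (2 * N : ℕ),
      logVarianceBound v₀ k) / Real.log (1 + N) ^ 2) Filter.atTop (𝓝 0) := by
  set A : ℝ := 4 + 16 * ∫ x, x ^ 6 ∂gaussianReal 0 1 with hA
  have hA0 : 0 ≤ A := by
    have : 0 ≤ ∫ x, x ^ 6 ∂gaussianReal 0 1 := integral_nonneg fun x => by positivity
    positivity
  have hsum : ∀ M : ℕ, ∑ k ∈ Finset.Icc (-(M : ℤ)) M, logVarianceBound v₀ k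
      = v₀ + A * (2 * (harmonic M : ℝ)) := by
    intro M
    rw [← sum_Icc_abs_inv, Finset.mul_sum]
    have : ∀ k : ℤ, logVarianceBound v₀ k = (if k = 0 then (v₀ : ℝ) else 0) + A * |(k : ℝ)|⁻¹ := by
      intro k
      by_cases hk : k = 0 <;> simp [logVarianceBound, hk, hA]
    simp only [this, Finset.sum_add_distrib]
    congr 1
    rw [Finset.sum_ite_eq' _ 0, if_pos (by simp)]
  have hbound : ∀ N : ℕ, 0 < N → (harmonic (2 * N) : ℝ) ≤ 1 + Real.log 2 + Real.log (1 + N) := by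
    intro N hN
    have hN' : (0 : ℝ) < N := by exact_mod_cast hN
    refine (harmonic_le_one_add_log _).trans ?_
    push_cast
    rw [Real.log_mul (by norm_num) hN'.ne', add_assoc]
    gcongr
    linarith
  have hlim : Filter.Tendsto (fun N : ℕ => (v₀ + A * (2 * (1 + Real.log 2))) /
      Real.log (1 + N) ^ 2 + A * 2 * (Real.log (1 + N))⁻¹) Filter.atTop (𝓝 0) := by
    have h1 := (tendsto_const_nhds (x := (v₀ : ℝ) + A * (2 * (1 + Real.log 2)))).div_atTop
      ((Filter.tendsto_pow_atTop (two_ne_zero)).comp tendsto_log_one_add_nat)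
    have h2 := tendsto_log_one_add_nat.inv_tendsto_atTop.const_mul (A * 2)
    simpa using h1.add h2
  refine squeeze_zero' (Filter.Eventually.of_forall fun N => ?_) ?_ hlim
  · rw [hsum]
    have h0 : (0 : ℝ) ≤ harmonic (2 * N) := by
      exact_mod_cast Finset.sum_nonneg fun i _ => by positivity
    positivity
  · filter_upwards [Filter.eventually_gt_atTop 0] with N hN
    have hN' : (0 : ℝ) < N := by exact_mod_cast hN
    have hlog : 0 < Real.log (1 + N) := Real.log_pos (by linarith)
    rw [hsum]
    calc _ ≤ (v₀ + A * (2 * (1 + Real.log 2 + Real.log (1 + N)))) / Real.log (1 + N) ^ 2 := by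
          gcongr
          exact hbound N hN
      _ = _ := by
          field_simp
          ring

/-- The labels in `S` of absolute value at most `2 * N`. -/
noncomputable def labelsUpTo (S : Set ℤ) (N : ℕ) : Finset ℤ :=
  open Classical in (Finset.Icc (-((2 * N : ℕ) : ℤ)) (2 * N : ℕ)).filter (· ∈ S)

lemma mem_labelsUpTo {S : Set ℤ} {N : ℕ} {k : ℤ} :
    k ∈ labelsUpTo S N ↔ |k| ≤ 2 * N ∧ k ∈ S := by
  simp [labelsUpTo, abs_le]

/-- The linear statistic of `logCutoff N`, restricted to the labels of absolute value at most
`2 * N`. -/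
noncomputable def logStatistic (S : Set ℤ) (N : ℕ) (w : ℤ → ℝ) : ℝ :=
  ∑ k ∈ labelsUpTo S N, logCutoff N (w k)

lemma variance_logStatistic_le (S : Set ℤ) (N : ℕ) {v : ℤ → ℝ≥0}
    (hv : ∀ k, k ≠ 0 → (v k : ℝ) ≤ |(k : ℝ)|) :
    Var[logStatistic S N; latticeLaw v]
      ≤ (∑ k ∈ Finset.Icc (-((2 * N : ℕ) : ℤ)) (2 * N : ℕ), logVarianceBound (v 0) k)
        / Real.log (1 + N) ^ 2 := by
  classical
  have hmp := fun k => measurePreserving_eval_latticeLaw v k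
  have hL : ∀ k, MemLp (fun w : ℤ → ℝ => logCutoff N (w k)) 2 (latticeLaw v) := fun k =>
    (memLp_logCutoff N _).comp_measurePreserving (hmp k)
  have hind : iIndepFun (fun (k : ℤ) (w : ℤ → ℝ) => logCutoff N (w k)) (latticeLaw v) :=
    iIndepFun_infinitePi fun _ => measurable_logCutoff N
  have hfun : logStatistic S N = ∑ k ∈ labelsUpTo S N, fun w : ℤ → ℝ => logCutoff N (w k) := by
    funext w
    simp [logStatistic]
  have hnn : ∀ k, 0 ≤ logVarianceBound (v 0) k := by
    intro k
    have : 0 ≤ ∫ x, x ^ 6 ∂gaussianReal 0 1 := integral_nonneg fun x => by positivity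
    unfold logVarianceBound
    split_ifs <;> positivity
  rw [hfun, IndepFun.variance_sum (fun k _ => hL k) fun j _ k _ hjk => hind.indepFun hjk,
    Finset.sum_div]
  refine (Finset.sum_le_sum fun k _ => ?_).trans (Finset.sum_le_sum_of_subset_of_nonneg
    (by unfold labelsUpTo; exact Finset.filter_subset _ _)
    fun k _ _ => div_nonneg (hnn k) (sq_nonneg _))
  have : Var[fun w : ℤ → ℝ => logCutoff N (w k); latticeLaw v]
      = Var[logCutoff N; gaussianReal k (v k)] := by
    rw [← (hmp k).map_eq, variance_map (measurable_logCutoff N).aemeasurable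
      (hmp k).measurable.aemeasurable]
    rfl
  rw [this]
  exact variance_logCutoff_le N hv k

lemma memLp_logStatistic (S : Set ℤ) (N : ℕ) (v : ℤ → ℝ≥0) :
    MemLp (logStatistic S N) 2 (latticeLaw v) :=
  memLp_finsetSum _ fun k _ =>
    (memLp_logCutoff N _).comp_measurePreserving (measurePreserving_eval_latticeLaw v k)

/-- Chebyshev's inequality gives convergence in probability, hence almost sure convergence along a
subsequence. -/
lemma exists_seq_tendsto_logStatistic (S : Set ℤ) {v : ℤ → ℝ≥0}
    (hv : ∀ k, k ≠ 0 → (v k : ℝ) ≤ |(k : ℝ)|) :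
    ∃ ns : ℕ → ℕ, StrictMono ns ∧ ∀ᵐ w ∂latticeLaw v,
      Filter.Tendsto (fun i => logStatistic S (ns i) w
        - ∫ w, logStatistic S (ns i) w ∂latticeLaw v) Filter.atTop (𝓝 0) := by
  have h : TendstoInMeasure (latticeLaw v) (fun N w => logStatistic S N w
      - ∫ w, logStatistic S N w ∂latticeLaw v) Filter.atTop 0 := by
    rw [tendstoInMeasure_iff_norm]
    intro ε hε
    have hlim := (tendsto_sum_logVarianceBound (v 0)).div_const (ε ^ 2)
    rw [zero_div] at hlim
    have hlim' := ENNReal.tendsto_ofReal hlim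
    rw [ENNReal.ofReal_zero] at hlim'
    refine tendsto_of_tendsto_of_tendsto_of_le_of_le tendsto_const_nhds hlim'
      (fun N => zero_le) fun N => ?_
    refine le_trans ?_ ((meas_ge_le_variance_div_sq (memLp_logStatistic S N v) hε).trans ?_)
    · simp only [Pi.zero_apply, sub_zero, Real.norm_eq_abs]
      exact le_rfl
    · refine ENNReal.ofReal_le_ofReal ?_
      gcongr
      exact variance_logStatistic_le S N hv
  exact h.exists_seq_tendsto_ae

lemma lintegral_configuration_restrict {S : Set ℤ} {D : Set ℝ} (hD : MeasurableSet D) (w : ℤ → ℝ)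
    {f : ℝ → ℝ≥0∞} (hf : Measurable f) :
    ∫⁻ x, f x ∂(configuration S w).restrict D = ∑' k : S, D.indicator f (w k) := by
  rw [← lintegral_indicator hD, configuration, lintegral_sum_measure]
  exact tsum_congr fun k => lintegral_dirac' _ (hf.indicator hD)

/-- The reason for truncating labels at 2N: a point with a larger label that is not far has |x| >
|k| / 2 > N, outside the support of the cutoff. -/
lemma logCutoff_eq_zero_of_not_far {N : ℕ} (hN : 0 < N) {k : ℤ} {x : ℝ} (hk : (2 * N : ℤ) < |k|)
    (hx : ¬ |(k : ℝ)| / 2 ≤ |x - (k : ℝ)|) : logCutoff N x = 0 := by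
  refine logCutoff_eq_zero hN ?_
  have h1 : (2 * N : ℝ) < |(k : ℝ)| := by exact_mod_cast hk
  have h2 := abs_sub_abs_le_abs_sub (k : ℝ) x
  rw [abs_sub_comm] at h2
  linarith

/-- The number of points in a bounded set is almost surely a function of the points outside. -/
theorem exists_configuration_apply_eq (S : Set ℤ) {v : ℤ → ℝ≥0}
    (hv : ∀ k, k ≠ 0 → (v k : ℝ) ≤ |(k : ℝ)|) {D : Set ℝ} (hD : MeasurableSet D)
    (hDb : Bornology.IsBounded D) :
    ∃ g : Measure ℝ → ℝ≥0∞, Measurable g ∧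
      ∀ᵐ w ∂latticeLaw v, configuration S w D = g ((configuration S w).restrict Dᶜ) := by
  obtain ⟨ns, hns, hlim⟩ := exists_seq_tendsto_logStatistic S hv
  set e : ℕ → ℝ := fun i => ∫ w, logStatistic S (ns i) w ∂latticeLaw v with he
  set G : ℕ → Measure ℝ → ℝ := fun i y =>
    (∫⁻ x, ENNReal.ofReal (logCutoff (ns i) x) ∂y).toReal with hG
  have hGm : ∀ i, Measurable (G i) := fun i =>
    (Measure.measurable_lintegral (measurable_logCutoff _).ennreal_ofReal).ennreal_toReal
  -- The mean of the statistic minus the contribution of the outside converges to the number of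
  -- points in `D`; `limsup` makes this a measurable function of every `y`.
  refine ⟨fun y => ENNReal.ofReal (Filter.limsup (fun i => e i - G i y) Filter.atTop),
    (Measurable.limsup fun i => (hGm i).const_sub (e i)).ennreal_ofReal, ?_⟩
  filter_upwards [hlim, ae_finite_far hv, ae_finite_mem_of_isBounded hv] with w hw hfar hfin
  have hTfin : {k | k ∈ S ∧ w k ∈ D}.Finite := (hfin D hDb).subset fun k hk => hk.2
  set T := hTfin.toFinset with hTdef
  have hT : ∀ k, k ∈ T ↔ k ∈ S ∧ w k ∈ D := fun k => by simp [hTdef]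
  have hcard := configuration_apply_eq_card hD hT
  obtain ⟨K, hK⟩ : ∃ K : ℕ, ∀ k ∈ hfar.toFinset ∪ T, |k| ≤ K := by
    refine ⟨∑ k ∈ hfar.toFinset ∪ T, k.natAbs, fun k hk => ?_⟩
    rw [Int.abs_eq_natAbs]
    exact_mod_cast Finset.single_le_sum (f := Int.natAbs) (fun _ _ => Nat.zero_le _) hk
  -- Once `ns i` exceeds all far labels and all labels of points in `D`, the full sum over the
  -- outside agrees with the truncated statistic minus the terms in `D`.
  have hev : ∀ᶠ i in Filter.atTop, G i ((configuration S w).restrict Dᶜ)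
      = logStatistic S (ns i) w - ∑ k ∈ T, logCutoff (ns i) (w k) := by
    filter_upwards [hns.tendsto_atTop.eventually_gt_atTop K] with i hi
    have hTsub : T ⊆ labelsUpTo S (ns i) := by
      intro k hk
      have := hK k (Finset.mem_union_right _ hk)
      rw [mem_labelsUpTo]
      exact ⟨by omega, ((hT k).1 hk).1⟩
    have h0 : ∀ k, (2 * ns i : ℤ) < |k| → logCutoff (ns i) (w k) = 0 := by
      intro k hk
      refine logCutoff_eq_zero_of_not_far (by omega) hk fun h => ?_
      have := hK k (Finset.mem_union_left _ (hfar.mem_toFinset.2 h))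
      omega
    simp only [hG]
    rw [lintegral_configuration_restrict hD.compl w (measurable_logCutoff _).ennreal_ofReal,
      tsum_subtype_eq_sum_of_finset (T := labelsUpTo S (ns i)) _ ?_
        fun k hk => (mem_labelsUpTo.1 hk).2, logStatistic, ← Finset.sum_sdiff hTsub,
      ← Finset.sum_sdiff hTsub, add_sub_cancel_right, Finset.sum_eq_zero (s := T), add_zero]
    · rw [← ENNReal.toReal_ofReal (Finset.sum_nonneg fun k _ => logCutoff_nonneg _ (w k)),
        ENNReal.ofReal_sum_of_nonneg fun k _ => logCutoff_nonneg _ (w k)]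
      congr 1
      refine Finset.sum_congr rfl fun k hk => ?_
      rw [Finset.mem_sdiff, hT, mem_labelsUpTo] at hk
      have hk' : w k ∈ Dᶜ := fun h => hk.2 ⟨hk.1.2, h⟩
      rw [indicator_of_mem hk']
    · intro k hk
      have hk' : w k ∉ Dᶜ := fun h => h ((hT k).1 hk).2
      rw [indicator_of_notMem hk']
    · intro k hkS hk
      rw [mem_labelsUpTo]
      refine ⟨?_, hkS⟩
      by_contra h
      push Not at h
      refine hk ?_
      simp [h0 k h]
  have hlimT : Filter.Tendsto (fun i => ∑ k ∈ T, logCutoff (ns i) (w k)) Filter.atTop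
      (𝓝 (T.card : ℝ)) := by
    have := tendsto_finsetSum T fun k _ => (tendsto_logCutoff (w k)).comp hns.tendsto_atTop
    simpa using this
  have hfinal : Filter.Tendsto (fun i => e i - G i ((configuration S w).restrict Dᶜ))
      Filter.atTop (𝓝 (T.card : ℝ)) := by
    have h := hlimT.sub hw
    rw [sub_zero] at h
    refine h.congr' ?_
    filter_upwards [hev] with i hi
    rw [hi]
    ring
  rw [hfinal.limsup_eq, hcard, ENNReal.ofReal_natCast]

-- Tolerance, the deterministic point, and transfer to the original space

lemma IsRegularCondDistrib.comp {Ω α E F : Type*} [MeasurableSpace Ω] [MeasurableSpace α]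
    [MeasurableSpace E] [MeasurableSpace F] {P : Measure Ω} {M : Measure α} {W : Ω → α}
    (hW : MeasurePreserving W P M) {X : α → F} {Y : α → E} (hX : Measurable X) (hY : Measurable Y)
    {κ : Kernel E F} (h : IsRegularCondDistrib M X Y κ) :
    IsRegularCondDistrib P (fun ω => X (W ω)) (fun ω => Y (W ω)) κ := by
  refine ⟨h.1, ?_⟩
  have h2 := h.2
  rw [← hW.map_eq, Measure.map_map (hY.prodMk hX) hW.measurable,
    Measure.map_map hY hW.measurable] at h2
  exact h2

lemma measurable_configuration_restrict (S : Set ℤ) {D : Set ℝ} (hD : MeasurableSet D) :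
    Measurable fun w => (configuration S w).restrict D := by
  refine Measure.measurable_of_measurable_coe _ fun B hB => ?_
  simp only [Measure.restrict_apply hB]
  exact (Measure.measurable_coe (hB.inter hD)).comp (measurable_configuration S)

lemma measurable_numPoints : Measurable numPoints := Measure.measurable_coe .univ

/-- The randomization theorem is used twice, with the outside configuration and with the count as
the preserved statistic. Number rigidity is needed only for the former, to make the count a function
of the statistic. -/
lemma exists_condDistrib_equivalent {S : Set ℤ} {v : ℤ → ℝ≥0}
    (hv : ∀ k, k ≠ 0 → (v k : ℝ) ≤ |(k : ℝ)|) {D : Set ℝ} [DecidablePred (· ∈ D)]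
    (hD : MeasurableSet D) (hDb : Bornology.IsBounded D) (Λ : ℝ≥0∞ → Measure (Measure ℝ))
    (hΛ : ∀ᵐ w ∂latticeLaw v,
      (resampleLaw D v).map (fun u => (configuration S (resample D (w, u))).restrict D)
        ≪ Λ (configuration S w D) ∧
      Λ (configuration S w D) ≪
        (resampleLaw D v).map fun u => (configuration S (resample D (w, u))).restrict D) :
    ∃ (κ : Kernel (Measure ℝ) (Measure ℝ)) (η : Kernel ℝ≥0∞ (Measure ℝ)),
      IsRegularCondDistrib (latticeLaw v) (fun w => (configuration S w).restrict D)
        (fun w => (configuration S w).restrict Dᶜ) κ ∧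
      IsRegularCondDistrib (latticeLaw v) (fun w => (configuration S w).restrict D)
        (fun w => numPoints ((configuration S w).restrict D)) η ∧
      ∀ᵐ w ∂latticeLaw v,
        (κ ((configuration S w).restrict Dᶜ) ≪ Λ (configuration S w D) ∧
          Λ (configuration S w D) ≪ κ ((configuration S w).restrict Dᶜ)) ∧
        (η (numPoints ((configuration S w).restrict D)) ≪ Λ (configuration S w D) ∧
          Λ (configuration S w D) ≪ η (numPoints ((configuration S w).restrict D))) := by
  have hnum : ∀ w, numPoints ((configuration S w).restrict D) = configuration S w D :=
    fun w => Measure.restrict_apply_univ D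
  have hn : Measurable fun w => configuration S w D :=
    (Measure.measurable_coe hD).comp (measurable_configuration S)
  have hinv := infinitePi_prod_map_resample hD fun k : ℤ => gaussianReal k (v k)
  have hu := ae_resample_mem hD v
  obtain ⟨g, hg, hgeq⟩ := exists_configuration_apply_eq S hv hD hDb
  obtain ⟨κ, hκ, hκ'⟩ := exists_regularCondDistrib_of_randomization (latticeLaw v)
    (resampleLaw D v) (measurable_resample hD) hinv
    (measurable_configuration_restrict S hD.compl)
    (by filter_upwards [hu] with p hp using configuration_resample_restrict_compl hD hp)
    (measurable_configuration_restrict S hD) hn hg hgeq Λ hΛ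
  obtain ⟨η, hη, hη'⟩ := exists_regularCondDistrib_of_randomization (latticeLaw v)
    (resampleLaw D v) (measurable_resample hD) hinv
    (Y := fun w => numPoints ((configuration S w).restrict D))
    (measurable_numPoints.comp (measurable_configuration_restrict S hD))
    (by
      filter_upwards [hu] with p hp
      rw [hnum, hnum]
      exact configuration_resample_apply hD hp)
    (measurable_configuration_restrict S hD) hn measurable_id
    (Filter.Eventually.of_forall fun w => (hnum w).symm) Λ hΛ
  refine ⟨κ, η, hκ, hη, ?_⟩
  filter_upwards [hκ', hη'] with w h1 h2 using ⟨h1, h2⟩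

/-- The equivalence class of the conditional law of the configuration in `D`, given that it has `x`
points. -/
lemma ae_resample_equivalent_lebesgueConfig {S : Set ℤ} {v : ℤ → ℝ≥0}
    (hv : ∀ k, k ≠ 0 → (v k : ℝ) ≤ |(k : ℝ)|) (hS : ∀ k ∈ S, v k ≠ 0) {D : Set ℝ}
    [DecidablePred (· ∈ D)] (hD : MeasurableSet D) (hDb : Bornology.IsBounded D) :
    ∀ᵐ w ∂latticeLaw v,
      (resampleLaw D v).map (fun u => (configuration S (resample D (w, u))).restrict D)
        ≪ lebesgueConfig D ⌊(configuration S w D).toReal⌋₊ ∧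
      lebesgueConfig D ⌊(configuration S w D).toReal⌋₊ ≪
        (resampleLaw D v).map fun u => (configuration S (resample D (w, u))).restrict D := by
  have hfin : ∀ᵐ w ∂latticeLaw v, {k | k ∈ S ∧ w k ∈ D}.Finite := by
    filter_upwards [ae_finite_mem_of_isBounded hv] with w hw
    exact (hw D hDb).subset fun k hk => hk.2
  filter_upwards [ae_resample_equivalent hD hS hfin] with w ⟨m, hm, h⟩
  rw [hm]
  simpa using h

lemma configuration_univ_eq (w : ℤ → ℝ) :
    configuration univ w = configuration {k | k ≠ 0} w + Measure.dirac (w 0) := by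
  refine Measure.ext fun B hB => ?_
  rw [Measure.add_apply, configuration_apply hB, configuration_apply hB,
    tsum_univ fun k : ℤ => B.indicator (1 : ℝ → ℝ≥0∞) (w k), Measure.dirac_apply' _ hB, add_comm,
    ← tsum_singleton (0 : ℤ) fun k => B.indicator (1 : ℝ → ℝ≥0∞) (w k)]
  exact (Summable.tsum_add_tsum_compl (f := fun k => B.indicator (1 : ℝ → ℝ≥0∞) (w k)) (s := {0})
    ENNReal.summable ENNReal.summable).symm

lemma ae_resample_equivalent_add_dirac {v : ℤ → ℝ≥0}
    (hv : ∀ k, k ≠ 0 → (v k : ℝ) ≤ |(k : ℝ)|) (hv0 : v 0 = 0) (hS : ∀ k, k ≠ 0 → v k ≠ 0)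
    {D : Set ℝ} [DecidablePred (· ∈ D)] (hD : MeasurableSet D) (hDb : Bornology.IsBounded D) :
    ∃ Λ : ℝ≥0∞ → Measure (Measure ℝ), ∀ᵐ w ∂latticeLaw v,
      (resampleLaw D v).map (fun u => (configuration univ (resample D (w, u))).restrict D)
        ≪ Λ (configuration univ w D) ∧
      Λ (configuration univ w D) ≪
        (resampleLaw D v).map fun u => (configuration univ (resample D (w, u))).restrict D := by
  set c : Measure ℝ := (Measure.dirac 0).restrict D with hc
  have hadd : Measurable fun μ : Measure ℝ => μ + c := measurable_id.add_const c
  -- `c univ` is 1 or 0 according to whether 0 lies in `D`: the fixed point is removed from the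
  -- count and put back into the configuration.
  refine ⟨fun x => (lebesgueConfig D ⌊(x - c univ).toReal⌋₊).map fun μ => μ + c, ?_⟩
  have h0 : ∀ᵐ w ∂latticeLaw v, w 0 = 0 := by
    simpa using ae_latticeLaw_eq_of_var_eq_zero (k := 0) hv0
  -- By invariance the resampled family has the same law, so its coordinate 0 is still almost surely
  -- 0.
  have hΦ : ∀ᵐ w ∂latticeLaw v, ∀ᵐ u ∂resampleLaw D v, resample D (w, u) 0 = 0 := by
    refine Measure.ae_ae_of_ae_prod (p := fun p => resample D p 0 = 0) ?_
    have hinv := infinitePi_prod_map_resample hD fun k : ℤ => gaussianReal k (v k)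
    exact ae_of_ae_map (measurable_resample hD).aemeasurable (p := fun w => w 0 = 0) (hinv ▸ h0)
  filter_upwards [h0, hΦ, ae_resample_equivalent_lebesgueConfig hv (S := {k | k ≠ 0})
    (fun k hk => hS k hk) hD hDb] with w hw hw' ⟨h1, h2⟩
  have hcount : configuration univ w D - c univ = configuration {k | k ≠ 0} w D := by
    rw [configuration_univ_eq, hw, Measure.add_apply, hc, Measure.restrict_apply_univ]
    exact ENNReal.add_sub_cancel_right (measure_ne_top _ _)
  have hmap : (resampleLaw D v).map
        (fun u => (configuration univ (resample D (w, u))).restrict D)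
      = ((resampleLaw D v).map
        fun u => (configuration {k | k ≠ 0} (resample D (w, u))).restrict D).map
          fun μ => μ + c := by
    have hm : Measurable fun u => (configuration {k | k ≠ 0} (resample D (w, u))).restrict D :=
      (measurable_configuration_restrict _ hD).comp
        ((measurable_resample hD).comp measurable_prodMk_left)
    rw [Measure.map_map hadd hm]
    refine Measure.map_congr ?_
    filter_upwards [hw'] with u hu
    rw [configuration_univ_eq, hu, Measure.restrict_add]
    rfl
  simp only [hcount]
  rw [hmap]
  exact ⟨h1.map hadd, h2.map hadd⟩

section Transfer

variable {Ω : Type*} [MeasurableSpace Ω] {P : Measure Ω} {W : Ω → ℤ → ℝ} {v : ℤ → ℝ≥0} {S : Set ℤ}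

lemma isSimplePointProcess_configuration (hW : MeasurePreserving W P (latticeLaw v))
    (hv : ∀ k, k ≠ 0 → (v k : ℝ) ≤ |(k : ℝ)|)
    (hS : ∀ j ∈ S, ∀ k ∈ S, j ≠ k → v j ≠ 0 ∨ v k ≠ 0) :
    IsSimplePointProcess P fun ω => configuration S (W ω) := by
  have hfin := hW.quasiMeasurePreserving.ae (ae_finite_mem_of_isBounded hv)
  have hcard : ∀ {w : ℤ → ℝ} {B : Set ℝ} (h : {k | w k ∈ B}.Finite), MeasurableSet B →
      configuration S w B = (h.subset fun k (hk : k ∈ {k | k ∈ S ∧ w k ∈ B}) =>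
        hk.2).toFinset.card := by
    intro w B h hB
    exact configuration_apply_eq_card hB fun k => by simp
  refine ⟨(measurable_configuration S).comp hW.measurable, ?_, ?_⟩
  · filter_upwards [hfin] with ω hω B hB hBm
    exact ⟨_, hcard (hω B hB) hBm⟩
  · filter_upwards [hfin, hW.quasiMeasurePreserving.ae (ae_injective hS)] with ω hω hinj x
    rw [hcard (hω {x} Bornology.isBounded_singleton) (measurableSet_singleton x)]
    have : ((((hω {x} Bornology.isBounded_singleton).subset
        fun k (hk : k ∈ {k | k ∈ S ∧ W ω k ∈ ({x} : Set ℝ)}) => hk.2).toFinset).card) ≤ 1 := by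
      rw [Finset.card_le_one]
      intro j hj k hk
      simp only [Finite.mem_toFinset, mem_ofPred_eq, mem_singleton_iff] at hj hk
      exact hinj j hj.1 k hk.1 (hj.2.trans hk.2.symm)
    exact_mod_cast this

lemma stronglyTolerant_configuration (hW : MeasurePreserving W P (latticeLaw v))
    (hv : ∀ k, k ≠ 0 → (v k : ℝ) ≤ |(k : ℝ)|) {D : Set ℝ} [DecidablePred (· ∈ D)]
    (hD : MeasurableSet D) (hDb : Bornology.IsBounded D) (Λ : ℝ≥0∞ → Measure (Measure ℝ))
    (hΛ : ∀ᵐ w ∂latticeLaw v,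
      (resampleLaw D v).map (fun u => (configuration S (resample D (w, u))).restrict D)
        ≪ Λ (configuration S w D) ∧
      Λ (configuration S w D) ≪
        (resampleLaw D v).map fun u => (configuration S (resample D (w, u))).restrict D) :
    StronglyTolerant P (fun ω => configuration S (W ω)) D numPoints := by
  obtain ⟨κ, η, hκ, hη, h⟩ := exists_condDistrib_equivalent hv hD hDb Λ hΛ
  have hX := measurable_configuration_restrict S hD
  refine ⟨κ, η, hκ.comp hW hX (measurable_configuration_restrict S hD.compl),
    hη.comp hW hX (measurable_numPoints.comp hX), ?_⟩
  filter_upwards [hW.quasiMeasurePreserving.ae h] with ω hω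
  exact ⟨hω.1.1.trans hω.2.2, hω.2.1.trans hω.1.2⟩

lemma IsRegularCondDistrib.cond_map_eq {E F : Type*} [MeasurableSpace E] [MeasurableSpace F]
    [MeasurableSingletonClass E] [IsFiniteMeasure P] {X : Ω → F} {Y : Ω → E} (hX : Measurable X)
    (hY : Measurable Y) {κ : Kernel E F} (h : IsRegularCondDistrib P X Y κ) {y : E}
    (hy : P {ω | Y ω = y} ≠ 0) :
    (ProbabilityTheory.cond P {ω | Y ω = y}).map X = κ y := by
  have := h.1
  have hYy : MeasurableSet {ω | Y ω = y} := hY (measurableSet_singleton y)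
  refine Measure.ext fun B hB => ?_
  have h1 : P.map (fun ω => (Y ω, X ω)) ({y} ×ˢ B) = ((P.map Y) ⊗ₘ κ) ({y} ×ˢ B) := by rw [h.2]
  rw [Measure.compProd_apply_prod (measurableSet_singleton y) hB, lintegral_singleton,
    Measure.map_apply hY (measurableSet_singleton y),
    Measure.map_apply (hY.prodMk hX) ((measurableSet_singleton y).prod hB)] at h1
  rw [Measure.map_apply hX hB, cond_apply hYy]
  have h2 : {ω | Y ω = y} ∩ X ⁻¹' B = (fun ω => (Y ω, X ω)) ⁻¹' ({y} ×ˢ B) := rfl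
  rw [h2, h1]
  change _ * (_ * P {ω | Y ω = y}) = _
  rw [mul_comm, mul_assoc, ENNReal.mul_inv_cancel hy (measure_ne_top _ _), mul_one]

theorem rigidAtLevelOne_configuration [IsFiniteMeasure P]
    (hW : MeasurePreserving W P (latticeLaw v))
    (hv : ∀ k, k ≠ 0 → (v k : ℝ) ≤ |(k : ℝ)|) (hS : ∀ k ∈ S, v k ≠ 0) :
    RigidAtLevelOne P fun ω => configuration S (W ω) := by
  classical
  refine ⟨isSimplePointProcess_configuration hW hv fun j hj _ _ _ => Or.inl (hS j hj),
    fun D hD hDb => ?_, fun D hD hDb m hm => ?_⟩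
  · exact stronglyTolerant_configuration hW hv hD.measurableSet hDb
      -- The count is almost surely a natural number, so the values at other `x` do not matter.
      (fun x => lebesgueConfig D ⌊x.toReal⌋₊)
      (ae_resample_equivalent_lebesgueConfig hv hS hD.measurableSet hDb)
  · obtain ⟨κ, η, -, hη, h⟩ := exists_condDistrib_equivalent hv hD.measurableSet hDb
      (fun x => lebesgueConfig D ⌊x.toReal⌋₊)
      (ae_resample_equivalent_lebesgueConfig hv hS hD.measurableSet hDb)
    have hX := measurable_configuration_restrict S hD.measurableSet
    have hη' : IsRegularCondDistrib P (fun ω => (configuration S (W ω)).restrict D)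
        (fun ω => numPoints ((configuration S (W ω)).restrict D)) η :=
      hη.comp hW hX (measurable_numPoints.comp hX)
    have hXW : Measurable fun ω => (configuration S (W ω)).restrict D := hX.comp hW.measurable
    have hYW : Measurable fun ω => numPoints ((configuration S (W ω)).restrict D) :=
      measurable_numPoints.comp hXW
    rw [hη'.cond_map_eq hXW hYW hm]
    -- The event of having m points is not null, so it contains an outcome where the almost sure
    -- equivalence holds; there it is a statement about the deterministic measure `η m`.
    obtain ⟨ω, hωm, hω⟩ := ((frequently_ae_mem_iff.2 hm).and_eventually
      (hW.quasiMeasurePreserving.ae h)).exists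
    have hωm' : numPoints ((configuration S (W ω)).restrict D) = m := hωm
    have hωD : configuration S (W ω) D = m := by
      rw [← hωm', numPoints, Measure.restrict_apply_univ]
    have := hω.2
    rw [hωm', hωD, ENNReal.toReal_natCast, Nat.floor_natCast] at this
    exact this

end Transfer

theorem theorem5 {Ω : Type*} [MeasurableSpace Ω] (P : Measure Ω) [IsProbabilityMeasure P]
    (β : ℝ) (v₀ : ℝ≥0) (Z : ℤ → Ω → ℝ)
    (hZ : ∀ k, Measurable (Z k))
    (hindep : iIndepFun Z P)
    (hlaw : ∀ k, P.map (Z k) =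
      gaussianReal 0 (if k = 0 then v₀ else (k.natAbs : ℝ≥0) ^ (2 * β))) :
    (1 / 2 < β → InsertionTolerant P (perturbedPoints univ Z)) ∧
    (β ≤ 1 / 2 →
      (v₀ ≠ 0 → RigidAtLevelOne P (perturbedPoints univ Z)) ∧
      (v₀ = 0 →
        IsSimplePointProcess P (perturbedPoints univ Z) ∧
        (∀ D : Set ℝ, IsOpen D → Bornology.IsBounded D →
          StronglyTolerant P (perturbedPoints univ Z) D numPoints) ∧
        RigidAtLevelOne P (perturbedPoints {k | k ≠ 0} Z))) := by
  classical
  obtain ⟨v, hvdef⟩ : ∃ v : ℤ → ℝ≥0,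
      ∀ k, v k = if k = 0 then v₀ else (k.natAbs : ℝ≥0) ^ (2 * β) := ⟨_, fun _ => rfl⟩
  simp only [← hvdef] at hlaw
  have hvk : ∀ k, k ≠ 0 → v k = (k.natAbs : ℝ≥0) ^ (2 * β) := fun k hk => by rw [hvdef, if_neg hk]
  have hv0 : v 0 = v₀ := by rw [hvdef, if_pos rfl]
  have hvne : ∀ k, k ≠ 0 → v k ≠ 0 := by
    intro k hk
    rw [hvk k hk]
    have : (k.natAbs : ℝ≥0) ≠ 0 := by simpa using hk
    exact (NNReal.rpow_pos (pos_iff_ne_zero.2 this)).ne'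
  refine ⟨fun hβ => insertionTolerant_perturbedPoints hZ hindep hlaw (by linarith) hvk,
    fun hβ => ?_⟩
  have hv : ∀ k, k ≠ 0 → (v k : ℝ) ≤ |(k : ℝ)| := by
    intro k hk
    have h1 : (1 : ℝ) ≤ |(k : ℝ)| := by exact_mod_cast Int.one_le_abs hk
    rw [hvk k hk, NNReal.coe_rpow, NNReal.coe_natCast, Nat.cast_natAbs, Int.cast_abs]
    calc _ ≤ |(k : ℝ)| ^ (1 : ℝ) := Real.rpow_le_rpow_of_exponent_le h1 (by linarith)
      _ = _ := Real.rpow_one _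
  have hW : MeasurePreserving (fun ω (k : ℤ) => (k : ℝ) + Z k ω) P (latticeLaw v) :=
    ⟨measurable_pi_iff.2 fun k => (hZ k).const_add _,
      map_perturbed_eq_latticeLaw hZ hindep hlaw⟩
  have hX : ∀ S, perturbedPoints S Z
      = fun ω => configuration S fun k : ℤ => (k : ℝ) + Z k ω := fun S => rfl
  rw [hX, hX]
  refine ⟨fun h0 => rigidAtLevelOne_configuration hW hv fun k _ => ?_, fun h0 => ⟨?_, ?_, ?_⟩⟩
  · by_cases hk : k = 0
    · rwa [hk, hv0]
    · exact hvne k hk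
  · refine isSimplePointProcess_configuration hW hv fun j _ k _ hjk => ?_
    by_cases hj : j = 0
    · exact Or.inr (hvne k fun hk => hjk (hj.trans hk.symm))
    · exact Or.inl (hvne j hj)
  · intro D hD hDb
    obtain ⟨Λ, hΛ⟩ := ae_resample_equivalent_add_dirac hv (hv0.trans h0) hvne hD.measurableSet hDb
    exact stronglyTolerant_configuration hW hv hD.measurableSet hDb Λ hΛ
  · exact rigidAtLevelOne_configuration hW hv fun k hk => hvne k hk
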